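/- Let $\mathbb T=\mathbb R/2\pi\mathbb Z$. For $K>0$, a classical solution of the Kuramoto–Sakaguchi equation is a $C^1$ function $f=f(\theta,\omega,t)\ge 0$ on $\mathbb T\times\mathbb R\times[0,\infty)$, with $f(\cdot,\cdot,t)$ integrable for each $t\ge0$ and $\iint_{\mathbb T\times\mathbb R} f(\theta,\omega,0)\,d\theta\,d\omega=1$, that satisfies, for $t>0$, $$\partial_t f+\partial_\theta\Big(\Big[\omega-K\int_{\mathbb T}\sin(\theta-\theta_*)\rho(\theta_*,t)\,d\theta_*\Big]f\Big)=0,\qquad \rho(\theta,t)=\int_{\mathbb R}f(\theta,\omega,t)\,d\omega .$$ Put $g(\omega)=\int_{\mathbb T}f(\theta,\omega,0)\,d\theta$, and define $R(t)\ge0$ and $\varphi(t)\in\mathbb R$ by $R(t)e^{i\varphi(t)}=\int_{\mathbb T}e^{i\theta}\rho(\theta,t)\,d\theta$ (any choice of $\varphi(t)$ is allowed where it is not unique). For $M,K>0$ set $$R_\infty=1+\frac MK-\sqrt{\frac{M^2}{K^2}+\frac{4M}{K}},\qquad w_\infty=\arccos\sqrt{1-\Big[\frac MK\,\frac{1+R_\infty}{R_\infty^2}+\frac{1-R_\infty}{R_\infty}\Big]^2}.$$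 **Theorem 3.3.** Let $M>0$. For every $R_0>0$ there is $K_0>0$, depending only on $M$ and $R_0$, such that for every $K>K_0$ and every classical solution $f$ with $\operatorname{supp} g\subset[-M,M]$ and $R(0)=R_0$ the following hold. 1. $\displaystyle\liminf_{t\to\infty}R(t)\ \ge\ R_\infty .$ 2. For every $\varepsilon\in(0,1)$, let $L_\infty(t)\subset\mathbb T$ be the interval centred at $\varphi(t)$ of constant width (total length) $w_\infty+\varepsilon$, that is, the set of points at circle distance less than $(w_\infty+\varepsilon)/2$ from $\varphi(t)$. Then $$\lim_{t\to\infty}\big\|f(\cdot,\cdot,t)\,\mathbb 1_{\mathbb T\setminus L_\infty(t)}\big\|_{L^\infty(\mathbb T\times\mathbb R)}=0 .$$ Moreover, for fixed $M$, as $K\to\infty$ we have $R_\infty\to1$ and $w_\infty\to0$. -/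

import Mathlib

open Real Set Filter Topology MeasureTheory

noncomputable section

namespace KuramotoSakaguchi

/-- Local mass density `ρ(θ, t) = ∫ f(θ, ω, t) dω`. Functions on the circle `𝕋 = ℝ / 2πℤ` are
represented by `2π`-periodic functions of a real variable. -/
def density (f : ℝ → ℝ → ℝ → ℝ) (θ t : ℝ) : ℝ :=
  ∫ ω, f θ ω t

/-- Interaction term `F[ρ](θ, t) = ∫_𝕋 sin (θ - θ') ρ(θ', t) dθ'`. -/
def interaction (f : ℝ → ℝ → ℝ → ℝ) (θ t : ℝ) : ℝ :=
  ∫ θ' in (0 : ℝ)..(2 * π), sin (θ - θ') * density f θ' t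

/-- Velocity field `v[f](θ, ω, t) = ω - K F[ρ](θ, t)`. -/
def velocity (K : ℝ) (f : ℝ → ℝ → ℝ → ℝ) (θ ω t : ℝ) : ℝ :=
  ω - K * interaction f θ t

/-- Natural frequency density `g(ω) = ∫_𝕋 f(θ, ω, 0) dθ` of the initial datum. -/
def frequencyDensity (f : ℝ → ℝ → ℝ → ℝ) (ω : ℝ) : ℝ :=
  ∫ θ in (0 : ℝ)..(2 * π), f θ ω 0

/-- Lebesgue measure on `𝕋 × ℝ`, with `(0, 2π]` as fundamental domain of the circle. -/
def phaseMeasure : Measure (ℝ × ℝ) :=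
  (volume.restrict (Ioc 0 (2 * π))).prod volume

/-- `f = f(θ, ω, t)` is a classical (`C¹` up to `t = 0`) solution, with values probability
densities on `𝕋 × ℝ`, of `∂ₜ f + ∂_θ (v[f] f) = 0`. That the total mass is one is
only required of the initial datum. -/
structure IsClassicalSolution (K : ℝ) (f : ℝ → ℝ → ℝ → ℝ) : Prop where
  periodic : ∀ ω t, 0 ≤ t → Function.Periodic (fun θ => f θ ω t) (2 * π)
  contDiffOn : ContDiffOn ℝ 1 (fun p : ℝ × ℝ × ℝ => f p.1 p.2.1 p.2.2) {p | 0 ≤ p.2.2}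
  nonneg : ∀ θ ω t, 0 ≤ t → 0 ≤ f θ ω t
  integrable : ∀ t, 0 ≤ t → Integrable (fun p : ℝ × ℝ => f p.1 p.2 t) phaseMeasure
  initial_mass : ∫ p : ℝ × ℝ, f p.1 p.2 0 ∂phaseMeasure = 1
  equation : ∀ θ ω t, 0 < t →
    deriv (fun s => f θ ω s) t + deriv (fun ϑ => velocity K f ϑ ω t * f ϑ ω t) θ = 0

/-- Complex order parameter `R(t) exp(i φ(t)) = ∫_𝕋 exp(iθ) ρ(θ, t) dθ`. -/
def complexOrder (f : ℝ → ℝ → ℝ → ℝ) (t : ℝ) : ℂ :=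
  ∫ θ in (0 : ℝ)..(2 * π), Complex.exp (θ * Complex.I) * (density f θ t : ℂ)

/-- Amplitude order parameter `R(t)`. -/
def amplitude (f : ℝ → ℝ → ℝ → ℝ) (t : ℝ) : ℝ :=
  ‖complexOrder f t‖

/-- `φ` is an average phase: `R(t) exp(i φ(t))` is the complex order parameter. It is unique
modulo `2π` at the times at which `R(t) > 0`. -/
def IsAveragePhase (f : ℝ → ℝ → ℝ → ℝ) (φ : ℝ → ℝ) : Prop :=
  ∀ t, 0 ≤ t → (amplitude f t : ℂ) * Complex.exp (φ t * Complex.I) = complexOrder f t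

/-- `R_∞ = 1 + M/K - √(M²/K² + 4 M/K)`. -/
def limitAmplitude (M K : ℝ) : ℝ :=
  1 + M / K - √(M ^ 2 / K ^ 2 + 4 * (M / K))

/-- The width, without the summand `ε`, of the concentration interval. -/
def baseWidth (M K : ℝ) : ℝ :=
  arccos √(1 - (M / K * ((1 + limitAmplitude M K) / limitAmplitude M K ^ 2)
    + (1 - limitAmplitude M K) / limitAmplitude M K) ^ 2)

/-- The interval of the circle with centre `c` and (total) width `w`, as a `2π`-periodic subset
of the real line. -/
def arc (c w : ℝ) : Set ℝ :=
  {θ | ∃ n : ℤ, |θ - (c + 2 * π * n)| < w / 2}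

/-- The norm in `L^∞(𝕋 × ℝ)` of `f(·, ·, t)` times the indicator of the complement of `A`. -/
def supNormOutside (f : ℝ → ℝ → ℝ → ℝ) (t : ℝ) (A : Set ℝ) : ENNReal :=
  eLpNorm (({p : ℝ × ℝ | p.1 ∉ A}).indicator (fun p => f p.1 p.2 t)) ⊤ phaseMeasure

end KuramotoSakaguchi

end

/-!
The order parameter `R e^{iφ}` of the density obeys a gradient-like structure, and everything follows
from one nondecreasing quantity. Write `ν = ω - ω̄` for the natural frequency relative to its mean
`ω̄` and `u = ν - K R sin (θ - φ)` for the velocity in the frame rotating at the rate `ω̄`, the *slip*.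
Testing the equation with `cos` and `sin` gives `d/dt (K R² / 2) = ∫ u² - ∫ ν u`. The last integral is
nearly the derivative of `∫ ν x`, where `x = θ - φ` is the phase relative to the order parameter;
since `x` is not a function on the circle, it is replaced by a `2π`-periodic function `P` of `x` with
derivative one near the multiples of `π`. The errors live where `|sin x| ≥ 1/2`. There `|u|` is of
order `K R`, so that for large `K` they are absorbed by half of the dissipation `D = ∫ u²`
(`sawtooth_error_le`, `IsMeanField.hasDerivAt_energy`). Hence `K R² / 2 + ∫ ν P(x)` is nondecreasing
with rate at least `D / 2`. As the second term is bounded independently of `K`, the modulus `R` stays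
above half its initial value forever (`IsMeanField.le_orderNorm`), with a threshold on `K` that
depends on `M` and `R(0)` only. As the energy is bounded and `D` is Lipschitz, `D → 0`
(`IsMeanField.tendsto_dissipation`), and since `R |φ' - ω̄| ≤ √D`, the order parameter eventually
rotates at nearly the mean frequency (`IsMeanField.sq_phaseSpeed_sub_le`).

From then on, characteristics move towards `x = 0` outside small neighbourhoods of `0` and `π`, while
near `π` the flow is expanding and the density decreases along it. The weight
`max (κ - cos x) 0 ^ 8` with `κ = 1 - M / (8 K)` combines both effects: the weighted density decays
exponentially along every characteristic (`rate_le`, `IsMeanField.mul_weight_le`). So the density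
tends to zero uniformly where `cos x ≤ 1 - M / (4 K)`. For large `K` this region contains the
complement of the arc of width `w_∞`, as `w_∞` is of order `2 √(M / K)`
(`cos_half_baseWidth_le`), and it follows that `R` eventually exceeds every number below
`1 - M / (4 K)`, in particular `R_∞`.

The natural frequencies stay in `[-M, M]`, because the mass at each set of frequencies is conserved
(`IsTransported.eq_zero_of_integral_eq_zero`); therefore all averages are integrals of continuous
functions over a compact box and can be differentiated under the integral sign.
-/

noncomputable section

namespace KuramotoSakaguchi

/-! ### Transport of averages -/

/-- The compact part `[0, 2π] × [A, B]` of phase space, with the closed fundamental domain of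
the circle. -/
def box (A B : ℝ) : Set (ℝ × ℝ) :=
  Icc 0 (2 * π) ×ˢ Icc A B

theorem isCompact_box (A B : ℝ) : IsCompact (box A B) :=
  isCompact_Icc.prod isCompact_Icc

theorem measurableSet_box (A B : ℝ) : MeasurableSet (box A B) :=
  (isCompact_box A B).measurableSet

theorem integrableOn_box {g : ℝ × ℝ → ℝ} (hg : Continuous g) (A B : ℝ) :
    IntegrableOn g (box A B) :=
  hg.continuousOn.integrableOn_compact (isCompact_box A B)

theorem integral_box_eq {g : ℝ × ℝ → ℝ} (hg : Continuous g) (A B : ℝ) :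
    ∫ p in box A B, g p = ∫ ω in Icc A B, ∫ θ in (0 : ℝ)..(2 * π), g (θ, ω) := by
  have hi := integrableOn_box hg A B
  rw [IntegrableOn, box, Measure.volume_eq_prod, ← Measure.prod_restrict] at hi
  rw [box, Measure.volume_eq_prod, ← Measure.prod_restrict, integral_prod_symm _ hi]
  refine integral_congr_ae (Eventually.of_forall fun ω => ?_)
  simp only
  rw [intervalIntegral.integral_of_le (by positivity), integral_Icc_eq_integral_Ioc]

/-- `F` solves `∂ₜ F + ∂_θ ((ω - K (c(t) sin θ - s(t) cos θ)) F) = 0` for `t > 0`, where `c` and `s`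
are arbitrary functions of time. The density `F` is defined and continuous for all times, so that
no one-sided limits at `t = 0` are needed. -/
structure IsTransported (K : ℝ) (c s : ℝ → ℝ) (F : ℝ × ℝ × ℝ → ℝ) : Prop where
  continuous : Continuous F
  contDiffOn : ContDiffOn ℝ 1 F {p | 0 < p.2.2}
  periodic : ∀ ω t, Function.Periodic (fun θ => F (θ, ω, t)) (2 * π)
  nonneg : ∀ p, 0 ≤ F p
  equation : ∀ θ ω t, 0 < t → deriv (fun τ => F (θ, ω, τ)) t +
    deriv (fun ϑ => (ω - K * (sin ϑ * c t - cos ϑ * s t)) * F (ϑ, ω, t)) θ = 0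

theorem isOpen_pos_time : IsOpen {p : ℝ × ℝ × ℝ | 0 < p.2.2} :=
  isOpen_lt continuous_const (by fun_prop)

namespace IsTransported

variable {K : ℝ} {c s : ℝ → ℝ} {F : ℝ × ℝ × ℝ → ℝ}

theorem hasFDerivAt (h : IsTransported K c s F) (θ ω : ℝ) {t : ℝ} (ht : 0 < t) :
    HasFDerivAt F (fderiv ℝ F (θ, ω, t)) (θ, ω, t) :=
  ((h.contDiffOn.contDiffAt (isOpen_pos_time.mem_nhds ht)).differentiableAt
    (by simp)).hasFDerivAt

theorem hasDerivAt_time (h : IsTransported K c s F) (θ ω : ℝ) {t : ℝ} (ht : 0 < t) :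
    HasDerivAt (fun τ => F (θ, ω, τ)) (fderiv ℝ F (θ, ω, t) (0, 0, 1)) t :=
  (h.hasFDerivAt θ ω ht).comp_hasDerivAt t
    ((hasDerivAt_const t θ).prodMk ((hasDerivAt_const t ω).prodMk (hasDerivAt_id t)))

theorem hasDerivAt_phase (h : IsTransported K c s F) (θ ω : ℝ) {t : ℝ} (ht : 0 < t) :
    HasDerivAt (fun ϑ => F (ϑ, ω, t)) (fderiv ℝ F (θ, ω, t) (1, 0, 0)) θ :=
  (h.hasFDerivAt θ ω ht).comp_hasDerivAt θ
    ((hasDerivAt_id θ).prodMk ((hasDerivAt_const θ ω).prodMk (hasDerivAt_const θ t)))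

theorem hasDerivAt_velocity (K ω a b θ : ℝ) :
    HasDerivAt (fun ϑ => ω - K * (sin ϑ * a - cos ϑ * b))
      (-(K * (cos θ * a + sin θ * b))) θ := by
  have := ((((Real.hasDerivAt_sin θ).mul_const a).sub
    ((Real.hasDerivAt_cos θ).mul_const b)).const_mul K).const_sub ω
  exact this.congr_deriv (by ring)

/-- The equation in non-divergence form. -/
theorem fderiv_time_eq (h : IsTransported K c s F) (θ ω : ℝ) {t : ℝ} (ht : 0 < t) :
    fderiv ℝ F (θ, ω, t) (0, 0, 1) = K * (cos θ * c t + sin θ * s t) * F (θ, ω, t)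
      - (ω - K * (sin θ * c t - cos θ * s t)) * fderiv ℝ F (θ, ω, t) (1, 0, 0) := by
  have h1 := h.equation θ ω t ht
  rw [(h.hasDerivAt_time θ ω ht).deriv,
    ((hasDerivAt_velocity K ω (c t) (s t) θ).fun_mul (h.hasDerivAt_phase θ ω ht)).deriv] at h1
  linarith

theorem continuousOn_fderiv_apply (h : IsTransported K c s F) (v : ℝ × ℝ × ℝ) :
    ContinuousOn (fun p => fderiv ℝ F p v) {p | 0 < p.2.2} :=
  (h.contDiffOn.continuousOn_fderiv_of_isOpen isOpen_pos_time le_rfl).clm_apply continuousOn_const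

theorem continuous_fderiv_slice (h : IsTransported K c s F) (v : ℝ × ℝ × ℝ) {t : ℝ} (ht : 0 < t) :
    Continuous fun p : ℝ × ℝ => fderiv ℝ F (p.1, p.2, t) v :=
  (h.continuousOn_fderiv_apply v).comp_continuous (by fun_prop) fun _ => ht

/-- The spatial term integrates to zero, by periodicity. -/
theorem integral_flux_eq_zero (h : IsTransported K c s F) (A B : ℝ) {ψ ψθ : ℝ × ℝ × ℝ → ℝ}
    (hψ : Continuous ψ) (hψθ : Continuous ψθ)
    (hdθ : ∀ θ ω t, HasDerivAt (fun ϑ => ψ (ϑ, ω, t)) (ψθ (θ, ω, t)) θ)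
    (hper : ∀ ω t, Function.Periodic (fun θ => ψ (θ, ω, t)) (2 * π)) {t : ℝ} (ht : 0 < t) :
    ∫ p in box A B, (ψ (p.1, p.2, t) * fderiv ℝ F (p.1, p.2, t) (0, 0, 1)
      - (p.2 - K * (sin p.1 * c t - cos p.1 * s t)) * ψθ (p.1, p.2, t) * F (p.1, p.2, t)) = 0 := by
  have hF := h.continuous
  have hFt := h.continuous_fderiv_slice (0, 0, 1) ht
  rw [integral_box_eq (by fun_prop)]
  refine integral_eq_zero_of_ae (Eventually.of_forall fun ω => ?_)
  have hd : ∀ θ ∈ uIcc 0 (2 * π), HasDerivAt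
      (fun ϑ => -((ω - K * (sin ϑ * c t - cos ϑ * s t)) * F (ϑ, ω, t) * ψ (ϑ, ω, t)))
      (ψ (θ, ω, t) * fderiv ℝ F (θ, ω, t) (0, 0, 1)
        - (ω - K * (sin θ * c t - cos θ * s t)) * ψθ (θ, ω, t) * F (θ, ω, t)) θ := by
    intro θ _
    refine ((((hasDerivAt_velocity K ω (c t) (s t) θ).mul (h.hasDerivAt_phase θ ω ht)).mul
      (hdθ θ ω t)).neg).congr_deriv ?_
    simp only [Pi.mul_apply]
    rw [h.fderiv_time_eq θ ω ht]
    ring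
  have hc : Continuous fun θ => ψ (θ, ω, t) * fderiv ℝ F (θ, ω, t) (0, 0, 1)
        - (ω - K * (sin θ * c t - cos θ * s t)) * ψθ (θ, ω, t) * F (θ, ω, t) := by
    have : Continuous fun θ => fderiv ℝ F (θ, ω, t) (0, 0, 1) :=
      hFt.comp (by fun_prop : Continuous fun θ : ℝ => (θ, ω))
    fun_prop
  simp only [Pi.zero_apply]
  rw [intervalIntegral.integral_eq_sub_of_hasDerivAt hd (hc.intervalIntegrable _ _)]
  have h1 := h.periodic ω t 0
  have h2 := hper ω t 0
  simp only [zero_add] at h1 h2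
  rw [h1, h2]
  simp

/-- Weak form of the transport equation. -/
theorem hasDerivAt_integral (h : IsTransported K c s F) (A B : ℝ) {ψ ψθ ψt : ℝ × ℝ × ℝ → ℝ}
    (hψ : Continuous ψ) (hψθ : Continuous ψθ) (hψt : Continuous ψt)
    (hdθ : ∀ θ ω t, HasDerivAt (fun ϑ => ψ (ϑ, ω, t)) (ψθ (θ, ω, t)) θ)
    (hdt : ∀ θ ω t, 0 < t → HasDerivAt (fun τ => ψ (θ, ω, τ)) (ψt (θ, ω, t)) t)
    (hper : ∀ ω t, Function.Periodic (fun θ => ψ (θ, ω, t)) (2 * π)) {t : ℝ} (ht : 0 < t) :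
    HasDerivAt (fun τ => ∫ p in box A B, ψ (p.1, p.2, τ) * F (p.1, p.2, τ))
      (∫ p in box A B, (ψt (p.1, p.2, t)
        + (p.2 - K * (sin p.1 * c t - cos p.1 * s t)) * ψθ (p.1, p.2, t)) * F (p.1, p.2, t)) t := by
  have hF := h.continuous
  have hFt := h.continuous_fderiv_slice (0, 0, 1) ht
  set G : ℝ → ℝ × ℝ → ℝ := fun τ p => ψt (p.1, p.2, τ) * F (p.1, p.2, τ)
    + ψ (p.1, p.2, τ) * fderiv ℝ F (p.1, p.2, τ) (0, 0, 1) with hG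
  have hcomp : IsCompact (Icc (t / 2) (2 * t) ×ˢ box A B) :=
    isCompact_Icc.prod (isCompact_box A B)
  have hGc : ContinuousOn (fun q : ℝ × ℝ × ℝ => G q.1 q.2) (Icc (t / 2) (2 * t) ×ˢ box A B) := by
    have h1 : ContinuousOn (fun q : ℝ × ℝ × ℝ => fderiv ℝ F (q.2.1, q.2.2, q.1) (0, 0, 1))
        (Icc (t / 2) (2 * t) ×ˢ box A B) := by
      refine (h.continuousOn_fderiv_apply (0, 0, 1)).comp
        (by fun_prop : Continuous fun q : ℝ × ℝ × ℝ => (q.2.1, q.2.2, q.1)).continuousOn ?_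
      rintro q ⟨hq, -⟩
      have := hq.1
      show 0 < q.1
      linarith
    simp only [hG]
    fun_prop
  obtain ⟨L, hL⟩ := hcomp.exists_bound_of_continuousOn hGc
  have hmain := (hasDerivAt_integral_of_dominated_loc_of_deriv_le
    (μ := volume.restrict (box A B)) (F := fun τ p => ψ (p.1, p.2, τ) * F (p.1, p.2, τ))
    (F' := G) (bound := fun _ => L) (s := Icc (t / 2) (2 * t)) (x₀ := t)
    (Icc_mem_nhds (by linarith) (by linarith))
    (Eventually.of_forall fun τ => (integrableOn_box (by fun_prop) A B).aestronglyMeasurable)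
    (integrableOn_box (by fun_prop) A B)
    (integrableOn_box (by simp only [hG]; fun_prop) A B).aestronglyMeasurable
    ((ae_restrict_iff' (measurableSet_box A B)).2 (Eventually.of_forall fun p hp τ hτ =>
      hL (τ, p) ⟨hτ, hp⟩))
    (integrableOn_box continuous_const A B)
    (Eventually.of_forall fun p τ hτ => by
      have hτ0 : 0 < τ := by linarith [hτ.1]
      exact (hdt p.1 p.2 τ hτ0).mul (h.hasDerivAt_time p.1 p.2 hτ0))).2
  refine hmain.congr_deriv ?_
  rw [← sub_eq_zero, ← integral_sub
    (integrableOn_box (by simp only [hG]; fun_prop) A B) (integrableOn_box (by fun_prop) A B),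
    ← h.integral_flux_eq_zero A B hψ hψθ hdθ hper ht]
  refine integral_congr_ae (Eventually.of_forall fun p => ?_)
  simp only [hG]
  ring

theorem continuous_integral (hF : Continuous F) (A B : ℝ) {ψ : ℝ × ℝ × ℝ → ℝ}
    (hψ : Continuous ψ) :
    Continuous fun τ => ∫ p in box A B, ψ (p.1, p.2, τ) * F (p.1, p.2, τ) :=
  continuous_parametric_integral_of_continuous
    (f := fun τ (p : ℝ × ℝ) => ψ (p.1, p.2, τ) * F (p.1, p.2, τ))
    (by unfold Function.uncurry; fun_prop) (isCompact_box A B)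

/-- Averages of functions of the natural frequency alone are conserved. -/
theorem integral_frequency_eq (h : IsTransported K c s F) (A B : ℝ) {χ : ℝ → ℝ}
    (hχ : Continuous χ) {t : ℝ} (ht : 0 ≤ t) :
    ∫ p in box A B, χ p.2 * F (p.1, p.2, t) = ∫ p in box A B, χ p.2 * F (p.1, p.2, 0) := by
  rcases ht.eq_or_lt with rfl | ht
  · rfl
  obtain ⟨τ, -, hτ⟩ := exists_hasDerivAt_eq_slope
    (fun τ => ∫ p in box A B, χ p.2 * F (p.1, p.2, τ)) (fun _ => 0) ht
    (continuous_integral h.continuous A B (ψ := fun q => χ q.2.1) (by fun_prop)).continuousOn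
    (fun τ hτ => (h.hasDerivAt_integral A B (ψ := fun q => χ q.2.1) (ψθ := fun _ => 0)
      (ψt := fun _ => 0) (by fun_prop) continuous_const continuous_const
      (fun θ ω _ => hasDerivAt_const θ (χ ω)) (fun _ ω τ _ => hasDerivAt_const τ (χ ω))
      (fun _ _ _ => rfl) hτ.1).congr_deriv (by simp))
  have := ht.ne'
  field_simp at hτ
  linarith

/-- Frequencies absent from the initial datum remain absent. -/
theorem eq_zero_of_integral_eq_zero (h : IsTransported K c s F) {A B : ℝ}
    (h0 : ∫ p in box A B, F (p.1, p.2, 0) = 0) (θ : ℝ) {ω t : ℝ} (hω : ω ∈ Ioo A B)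
    (ht : 0 ≤ t) : F (θ, ω, t) = 0 := by
  have hF := h.continuous
  have h1 := h.integral_frequency_eq A B (χ := fun _ => 1) continuous_const ht
  simp only [one_mul, h0] at h1
  rw [setIntegral_eq_zero_iff_of_nonneg_ae (Eventually.of_forall fun p => h.nonneg _)
    (integrableOn_box (by fun_prop) A B)] at h1
  have hint : box A B ⊆ closure (interior (box A B)) := by
    rw [box, interior_prod_eq, closure_prod_eq, interior_Icc, interior_Icc,
      closure_Ioo (by positivity), closure_Ioo (hω.1.trans hω.2).ne]
  have h2 := Measure.eqOn_of_ae_eq h1 (by fun_prop) continuousOn_const hint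
  obtain ⟨y, hy, hyθ⟩ := (h.periodic ω t).exists_mem_Ico₀ (by positivity) θ
  rw [hyθ]
  exact h2 (x := (y, ω)) ⟨⟨hy.1, hy.2.le⟩, hω.1.le, hω.2.le⟩

end IsTransported

/-! ### Reduction to bounded frequencies -/

/-- Real part of the order parameter of a density carried by frequencies in `[-M, M]`. -/
def orderCos (M : ℝ) (F : ℝ × ℝ × ℝ → ℝ) (t : ℝ) : ℝ :=
  ∫ p in box (-M) M, cos p.1 * F (p.1, p.2, t)

/-- Imaginary part of the order parameter. -/
def orderSin (M : ℝ) (F : ℝ × ℝ × ℝ → ℝ) (t : ℝ) : ℝ :=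
  ∫ p in box (-M) M, sin p.1 * F (p.1, p.2, t)

/-- A solution of the Kuramoto–Sakaguchi equation carried by frequencies in `[-M, M]`, with the
order parameter expressed by averages over the compact set `box (-M) M`. -/
structure IsMeanField (M K : ℝ) (F : ℝ × ℝ × ℝ → ℝ) : Prop
    extends IsTransported K (orderCos M F) (orderSin M F) F where
  eq_zero : ∀ θ ω t, 0 ≤ t → M < |ω| → F (θ, ω, t) = 0
  mass : ∀ t, 0 ≤ t → ∫ p in box (-M) M, F (p.1, p.2, t) = 1

/-- The solution frozen at its initial datum for negative times, as a function of triples. -/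
def extend (f : ℝ → ℝ → ℝ → ℝ) (q : ℝ × ℝ × ℝ) : ℝ :=
  f q.1 q.2.1 (max q.2.2 0)

theorem extend_apply (f : ℝ → ℝ → ℝ → ℝ) (θ ω : ℝ) {t : ℝ} (ht : 0 ≤ t) :
    extend f (θ, ω, t) = f θ ω t := by
  simp [extend, max_eq_left ht]

namespace IsClassicalSolution

variable {K : ℝ} {f : ℝ → ℝ → ℝ → ℝ}

theorem intervalIntegrable_density (hf : IsClassicalSolution K f) {t : ℝ} (ht : 0 ≤ t) :
    IntervalIntegrable (fun θ => density f θ t) volume 0 (2 * π) := by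
  rw [intervalIntegrable_iff_integrableOn_Ioc_of_le (by positivity)]
  exact (hf.integrable t ht).integral_prod_left

theorem interaction_eq (hf : IsClassicalSolution K f) {t : ℝ} (ht : 0 ≤ t) (θ : ℝ) :
    interaction f θ t = sin θ * (∫ θ' in (0 : ℝ)..(2 * π), cos θ' * density f θ' t)
      - cos θ * (∫ θ' in (0 : ℝ)..(2 * π), sin θ' * density f θ' t) := by
  have hi := hf.intervalIntegrable_density ht
  rw [← intervalIntegral.integral_const_mul, ← intervalIntegral.integral_const_mul,
    ← intervalIntegral.integral_sub
      ((hi.continuousOn_mul continuous_cos.continuousOn).const_mul _)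
      ((hi.continuousOn_mul continuous_sin.continuousOn).const_mul _), interaction]
  refine intervalIntegral.integral_congr fun x _ => ?_
  simp only [sin_sub]
  ring

theorem isTransported_extend (hf : IsClassicalSolution K f) :
    IsTransported K (fun t => ∫ θ in (0 : ℝ)..(2 * π), cos θ * density f θ t)
      (fun t => ∫ θ in (0 : ℝ)..(2 * π), sin θ * density f θ t) (extend f) where
  continuous := hf.contDiffOn.continuousOn.comp_continuous
    (f := fun q : ℝ × ℝ × ℝ => (q.1, q.2.1, max q.2.2 0)) (by fun_prop)
    fun q => le_max_right q.2.2 0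
  contDiffOn := (hf.contDiffOn.mono fun p (hp : 0 < p.2.2) => hp.le).congr
    fun p (hp : 0 < p.2.2) => extend_apply f p.1 p.2.1 hp.le
  periodic ω t := hf.periodic ω _ (le_max_right t 0)
  nonneg p := hf.nonneg _ _ _ (le_max_right _ _)
  equation θ ω t ht := by
    refine Eq.trans ?_ (hf.equation θ ω t ht)
    congr 1
    · refine EventuallyEq.deriv_eq ?_
      filter_upwards [eventually_gt_nhds ht] with τ hτ using extend_apply f θ ω hτ.le
    · congr 1
      ext ϑ
      rw [extend_apply f ϑ ω ht.le, velocity, hf.interaction_eq ht.le]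

theorem eq_zero_of_lt_abs (hf : IsClassicalSolution K f) {M : ℝ}
    (hs : tsupport (frequencyDensity f) ⊆ Icc (-M) M) (θ : ℝ) {ω t : ℝ} (hω : M < |ω|)
    (ht : 0 ≤ t) : extend f (θ, ω, t) = 0 := by
  have h := hf.isTransported_extend
  have hg : ∀ x, x ∉ Icc (-M) M → frequencyDensity f x = 0 := fun x hx =>
    image_eq_zero_of_notMem_tsupport fun hx' => hx (hs hx')
  have key : ∀ A B, (∀ x ∈ Icc A B, x ∉ Icc (-M) M) → ω ∈ Ioo A B →
      extend f (θ, ω, t) = 0 := by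
    intro A B hAB hω'
    refine h.eq_zero_of_integral_eq_zero ?_ θ hω' ht
    have hF := h.continuous
    rw [integral_box_eq (g := fun p => extend f (p.1, p.2, 0)) (by fun_prop)]
    refine setIntegral_eq_zero_of_forall_eq_zero fun x hx => ?_
    refine Eq.trans ?_ (hg x (hAB x hx))
    exact intervalIntegral.integral_congr fun y _ => extend_apply f y x le_rfl
  rcases lt_abs.1 hω with hω | hω
  · exact key ((M + ω) / 2) (ω + 1) (fun x hx hx' => by linarith [hx.1, hx'.2])
      ⟨by linarith, by linarith⟩
  · exact key (ω - 1) ((ω - M) / 2) (fun x hx hx' => by linarith [hx.2, hx'.1])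
      ⟨by linarith, by linarith⟩

theorem density_eq (hf : IsClassicalSolution K f) {M : ℝ}
    (hs : tsupport (frequencyDensity f) ⊆ Icc (-M) M) (θ : ℝ) {t : ℝ} (ht : 0 ≤ t) :
    density f θ t = ∫ ω in Icc (-M) M, extend f (θ, ω, t) := by
  rw [setIntegral_eq_integral_of_forall_compl_eq_zero]
  · exact integral_congr_ae (Eventually.of_forall fun ω => (extend_apply f θ ω ht).symm)
  · intro ω hω
    refine hf.eq_zero_of_lt_abs hs θ ?_ ht
    contrapose! hω
    exact abs_le.1 hω

theorem integral_mul_density (hf : IsClassicalSolution K f) {M : ℝ}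
    (hs : tsupport (frequencyDensity f) ⊆ Icc (-M) M) {χ : ℝ → ℝ} (hχ : Continuous χ) {t : ℝ}
    (ht : 0 ≤ t) :
    ∫ θ in (0 : ℝ)..(2 * π), χ θ * density f θ t
      = ∫ p in box (-M) M, χ p.1 * extend f (p.1, p.2, t) := by
  have hF := hf.isTransported_extend.continuous
  rw [intervalIntegral.integral_of_le (by positivity), ← integral_Icc_eq_integral_Ioc, box,
    Measure.volume_eq_prod, setIntegral_prod]
  · refine integral_congr_ae (Eventually.of_forall fun θ => ?_)
    simp only
    rw [hf.density_eq hs θ ht, integral_const_mul]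
  · rw [← Measure.volume_eq_prod]
    exact integrableOn_box (by fun_prop) (-M) M

theorem isMeanField (hf : IsClassicalSolution K f) {M : ℝ}
    (hs : tsupport (frequencyDensity f) ⊆ Icc (-M) M) : IsMeanField M K (extend f) := by
  have h := hf.isTransported_extend
  refine ⟨⟨h.continuous, h.contDiffOn, h.periodic, h.nonneg, fun θ ω t ht => ?_⟩,
    fun θ ω t ht hω => hf.eq_zero_of_lt_abs hs θ hω ht, fun t ht => ?_⟩
  · rw [orderCos, orderSin, ← hf.integral_mul_density hs continuous_cos ht.le,
      ← hf.integral_mul_density hs continuous_sin ht.le]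
    exact h.equation θ ω t ht
  · have h1 := h.integral_frequency_eq (-M) M (χ := fun _ => 1) continuous_const ht
    have h2 := hf.integral_mul_density hs (χ := fun _ => 1) continuous_const le_rfl
    simp only [one_mul] at h1 h2
    rw [h1, ← h2, ← hf.initial_mass, phaseMeasure, integral_prod _ (hf.integrable 0 le_rfl),
      intervalIntegral.integral_of_le (by positivity)]
    rfl

theorem complexOrder_eq (hf : IsClassicalSolution K f) {M : ℝ}
    (hs : tsupport (frequencyDensity f) ⊆ Icc (-M) M) {t : ℝ} (ht : 0 ≤ t) :
    complexOrder f t = orderCos M (extend f) t + orderSin M (extend f) t * Complex.I := by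
  have hi := hf.intervalIntegrable_density ht
  rw [orderCos, orderSin, ← hf.integral_mul_density hs continuous_cos ht,
    ← hf.integral_mul_density hs continuous_sin ht, complexOrder,
    ← intervalIntegral.integral_ofReal, ← intervalIntegral.integral_ofReal,
    ← intervalIntegral.integral_mul_const, ← intervalIntegral.integral_add]
  · refine intervalIntegral.integral_congr fun x _ => ?_
    simp only [Complex.exp_mul_I]
    push_cast
    ring
  · have hc := hi.continuousOn_mul continuous_cos.continuousOn
    exact ⟨Integrable.ofReal hc.1, Integrable.ofReal hc.2⟩
  · have hs := hi.continuousOn_mul continuous_sin.continuousOn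
    exact IntervalIntegrable.mul_const ⟨Integrable.ofReal hs.1, Integrable.ofReal hs.2⟩ _

end IsClassicalSolution

/-! ### The order parameter in polar coordinates -/

/-- The velocity field of the mean-field flow. -/
def speed (M K : ℝ) (F : ℝ × ℝ × ℝ → ℝ) (q : ℝ × ℝ × ℝ) : ℝ :=
  q.2.1 - K * (sin q.1 * orderCos M F q.2.2 - cos q.1 * orderSin M F q.2.2)

/-- Time derivative of `orderCos`. -/
def orderCosDeriv (M K : ℝ) (F : ℝ × ℝ × ℝ → ℝ) (t : ℝ) : ℝ :=
  ∫ p in box (-M) M, -(sin p.1 * speed M K F (p.1, p.2, t)) * F (p.1, p.2, t)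

/-- Time derivative of `orderSin`. -/
def orderSinDeriv (M K : ℝ) (F : ℝ × ℝ × ℝ → ℝ) (t : ℝ) : ℝ :=
  ∫ p in box (-M) M, (cos p.1 * speed M K F (p.1, p.2, t)) * F (p.1, p.2, t)

/-- Modulus of the order parameter. -/
def orderNorm (M : ℝ) (F : ℝ × ℝ × ℝ → ℝ) (t : ℝ) : ℝ :=
  √(orderCos M F t ^ 2 + orderSin M F t ^ 2)

/-- Angular velocity of the order parameter. The denominator is truncated at `m ^ 2`, so that the
function is continuous even if the order parameter vanishes; it is the true angular velocity
wherever the modulus is at least `m`. -/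
def phaseSpeed (M K m : ℝ) (F : ℝ × ℝ × ℝ → ℝ) (t : ℝ) : ℝ :=
  (orderCos M F t * orderSinDeriv M K F t - orderSin M F t * orderCosDeriv M K F t)
    / max (orderCos M F t ^ 2 + orderSin M F t ^ 2) (m ^ 2)

/-- Continuous lift of the argument of the order parameter, starting at `φ₀`. -/
def phase (M K m φ₀ : ℝ) (F : ℝ × ℝ × ℝ → ℝ) (t : ℝ) : ℝ :=
  φ₀ + ∫ τ in (0 : ℝ)..t, phaseSpeed M K m F τ

namespace IsMeanField

variable {M K : ℝ} {F : ℝ × ℝ × ℝ → ℝ}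

theorem continuous_orderCos (h : IsMeanField M K F) : Continuous (orderCos M F) :=
  IsTransported.continuous_integral h.continuous (-M) M (ψ := fun q => cos q.1) (by fun_prop)

theorem continuous_orderSin (h : IsMeanField M K F) : Continuous (orderSin M F) :=
  IsTransported.continuous_integral h.continuous (-M) M (ψ := fun q => sin q.1) (by fun_prop)

theorem continuous_speed (h : IsMeanField M K F) : Continuous (speed M K F) := by
  have h1 := h.continuous_orderCos
  have h2 := h.continuous_orderSin
  unfold speed
  fun_prop

theorem continuous_orderCosDeriv (h : IsMeanField M K F) : Continuous (orderCosDeriv M K F) := by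
  have h1 := h.continuous_speed
  exact IsTransported.continuous_integral h.continuous (-M) M
    (ψ := fun q => -(sin q.1 * speed M K F q)) (by fun_prop)

theorem continuous_orderSinDeriv (h : IsMeanField M K F) : Continuous (orderSinDeriv M K F) := by
  have h1 := h.continuous_speed
  exact IsTransported.continuous_integral h.continuous (-M) M
    (ψ := fun q => cos q.1 * speed M K F q) (by fun_prop)

theorem continuous_orderNorm (h : IsMeanField M K F) : Continuous (orderNorm M F) := by
  have h1 := h.continuous_orderCos
  have h2 := h.continuous_orderSin
  unfold orderNorm
  fun_prop

theorem continuous_phaseSpeed (h : IsMeanField M K F) {m : ℝ} (hm : 0 < m) :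
    Continuous (phaseSpeed M K m F) := by
  have h1 := h.continuous_orderCos
  have h2 := h.continuous_orderSin
  have h3 := h.continuous_orderCosDeriv
  have h4 := h.continuous_orderSinDeriv
  unfold phaseSpeed
  refine Continuous.div (by fun_prop) (by fun_prop) fun t => ?_
  exact (lt_of_lt_of_le (by positivity : 0 < m ^ 2) (le_max_right _ _)).ne'

theorem hasDerivAt_phase_time (h : IsMeanField M K F) {m : ℝ} (hm : 0 < m) (φ₀ t : ℝ) :
    HasDerivAt (phase M K m φ₀ F) (phaseSpeed M K m F t) t :=
  ((h.continuous_phaseSpeed hm).integral_hasStrictDerivAt 0 t).hasDerivAt.const_add φ₀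

theorem continuous_phase (h : IsMeanField M K F) {m : ℝ} (hm : 0 < m) (φ₀ : ℝ) :
    Continuous (phase M K m φ₀ F) :=
  continuous_iff_continuousAt.2 fun t => (h.hasDerivAt_phase_time hm φ₀ t).continuousAt

/-- Weak form of the equation, with the velocity field `speed`. -/
theorem hasDerivAt_average (h : IsMeanField M K F) {ψ ψθ ψt : ℝ × ℝ × ℝ → ℝ}
    (hψ : Continuous ψ) (hψθ : Continuous ψθ) (hψt : Continuous ψt)
    (hdθ : ∀ θ ω t, HasDerivAt (fun ϑ => ψ (ϑ, ω, t)) (ψθ (θ, ω, t)) θ)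
    (hdt : ∀ θ ω t, 0 < t → HasDerivAt (fun τ => ψ (θ, ω, τ)) (ψt (θ, ω, t)) t)
    (hper : ∀ ω t, Function.Periodic (fun θ => ψ (θ, ω, t)) (2 * π)) {t : ℝ} (ht : 0 < t) :
    HasDerivAt (fun τ => ∫ p in box (-M) M, ψ (p.1, p.2, τ) * F (p.1, p.2, τ))
      (∫ p in box (-M) M, (ψt (p.1, p.2, t)
        + speed M K F (p.1, p.2, t) * ψθ (p.1, p.2, t)) * F (p.1, p.2, t)) t :=
  h.hasDerivAt_integral (-M) M hψ hψθ hψt hdθ hdt hper ht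

theorem hasDerivAt_orderCos (h : IsMeanField M K F) {t : ℝ} (ht : 0 < t) :
    HasDerivAt (orderCos M F) (orderCosDeriv M K F t) t := by
  refine (h.hasDerivAt_average (ψ := fun q => cos q.1) (ψθ := fun q => -sin q.1)
    (ψt := fun _ => 0) (by fun_prop) (by fun_prop) continuous_const
    (fun θ _ _ => Real.hasDerivAt_cos θ) (fun θ _ τ _ => hasDerivAt_const τ (cos θ))
    (fun _ _ => cos_periodic) ht).congr_deriv ?_
  refine integral_congr_ae (Eventually.of_forall fun p => ?_)
  simp only
  ring

theorem hasDerivAt_orderSin (h : IsMeanField M K F) {t : ℝ} (ht : 0 < t) :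
    HasDerivAt (orderSin M F) (orderSinDeriv M K F t) t := by
  refine (h.hasDerivAt_average (ψ := fun q => sin q.1) (ψθ := fun q => cos q.1)
    (ψt := fun _ => 0) (by fun_prop) (by fun_prop) continuous_const
    (fun θ _ _ => Real.hasDerivAt_sin θ) (fun θ _ τ _ => hasDerivAt_const τ (sin θ))
    (fun _ _ => sin_periodic) ht).congr_deriv ?_
  refine integral_congr_ae (Eventually.of_forall fun p => ?_)
  simp only
  ring

theorem orderNorm_sq (M : ℝ) (F : ℝ × ℝ × ℝ → ℝ) (t : ℝ) :
    orderNorm M F t ^ 2 = orderCos M F t ^ 2 + orderSin M F t ^ 2 :=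
  sq_sqrt (by positivity)

/-- As long as its modulus stays above `m`, the order parameter has argument `phase`. The two
components of the order parameter in the frame rotating with `phase`, divided by the modulus, have
derivative zero. -/
theorem orderCos_orderSin_eq (h : IsMeanField M K F) {m φ₀ T : ℝ} (hm : 0 < m) (hT : 0 ≤ T)
    (hR : ∀ t ∈ Icc 0 T, m ≤ orderNorm M F t)
    (hC₀ : orderCos M F 0 = orderNorm M F 0 * cos φ₀)
    (hS₀ : orderSin M F 0 = orderNorm M F 0 * sin φ₀) :
    orderCos M F T = orderNorm M F T * cos (phase M K m φ₀ F T) ∧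
    orderSin M F T = orderNorm M F T * sin (phase M K m φ₀ F T) := by
  set φ := phase M K m φ₀ F with hφ
  have hφc : Continuous φ := h.continuous_phase hm φ₀
  have hCc := h.continuous_orderCos
  have hSc := h.continuous_orderSin
  have hRc := h.continuous_orderNorm
  have hφ0 : φ 0 = φ₀ := by simp [hφ, phase]
  have hR0 : 0 < orderNorm M F 0 := hm.trans_le (hR 0 ⟨le_rfl, hT⟩)
  have hRT : 0 < orderNorm M F T := hm.trans_le (hR T ⟨hT, le_rfl⟩)
  have hconst : ∀ X : ℝ → ℝ, (∀ t ∈ Icc 0 T, ContinuousAt X t) →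
      (∀ t ∈ Ioo 0 T, HasDerivAt X 0 t) → X T = X 0 := by
    intro X hXc hXd
    rcases hT.eq_or_lt with rfl | hT'
    · rfl
    obtain ⟨τ, -, hτ⟩ := exists_hasDerivAt_eq_slope X (fun _ => 0) hT'
      (fun t ht => (hXc t ht).continuousWithinAt) hXd
    have := hT'.ne'
    field_simp at hτ
    linarith
  have hderiv : ∀ t ∈ Ioo 0 T,
      HasDerivAt (fun τ => (orderCos M F τ * cos (φ τ) + orderSin M F τ * sin (φ τ))
        / orderNorm M F τ) 0 t ∧
      HasDerivAt (fun τ => (orderSin M F τ * cos (φ τ) - orderCos M F τ * sin (φ τ))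
        / orderNorm M F τ) 0 t := by
    intro t ht
    have hRt : m ≤ orderNorm M F t := hR t ⟨ht.1.le, ht.2.le⟩
    have hpos : 0 < orderNorm M F t := hm.trans_le hRt
    have hsq := orderNorm_sq M F t
    have hC := h.hasDerivAt_orderCos ht.1
    have hS := h.hasDerivAt_orderSin ht.1
    have hΦ := h.hasDerivAt_phase_time hm φ₀ t
    rw [← hφ] at hΦ
    have hcos := hΦ.cos
    have hsin := hΦ.sin
    have hN : HasDerivAt (orderNorm M F) ((orderCos M F t * orderCosDeriv M K F t
        + orderSin M F t * orderSinDeriv M K F t) / orderNorm M F t) t := by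
      refine (((hC.pow 2).add (hS.pow 2)).sqrt ?_).congr_deriv ?_
      · simp only [Pi.add_apply, Pi.pow_apply]
        rw [← hsq]
        positivity
      · simp only [Pi.add_apply, Pi.pow_apply]
        change _ / (2 * orderNorm M F t) = _
        field_simp
        ring
    have hspeed : phaseSpeed M K m F t * orderNorm M F t ^ 2
        = orderCos M F t * orderSinDeriv M K F t
          - orderSin M F t * orderCosDeriv M K F t := by
      have hle : m ^ 2 ≤ orderNorm M F t ^ 2 := by gcongr
      rw [phaseSpeed, ← hsq, max_eq_left hle]
      field_simp
    constructor
    · refine (((hC.mul hcos).add (hS.mul hsin)).div hN hpos.ne').congr_deriv ?_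
      simp only [Pi.add_apply, Pi.mul_apply]
      field_simp
      linear_combination (orderSin M F t * cos (φ t) - orderCos M F t * sin (φ t)) * hspeed
        + (orderCosDeriv M K F t * cos (φ t) + orderSinDeriv M K F t * sin (φ t)) * hsq
    · refine (((hS.mul hcos).sub (hC.mul hsin)).div hN hpos.ne').congr_deriv ?_
      simp only [Pi.sub_apply, Pi.mul_apply]
      field_simp
      linear_combination
        -(orderSin M F t * sin (φ t) + orderCos M F t * cos (φ t)) * hspeed
        + (orderSinDeriv M K F t * cos (φ t) - orderCosDeriv M K F t * sin (φ t)) * hsq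
  have hne : ∀ t ∈ Icc 0 T, orderNorm M F t ≠ 0 := fun t ht => (hm.trans_le (hR t ht)).ne'
  have hA := hconst _ (fun t ht => ((by fun_prop : Continuous fun τ =>
    orderCos M F τ * cos (φ τ) + orderSin M F τ * sin (φ τ)).continuousAt).div
      hRc.continuousAt (hne t ht)) fun t ht => (hderiv t ht).1
  have hB := hconst _ (fun t ht => ((by fun_prop : Continuous fun τ =>
    orderSin M F τ * cos (φ τ) - orderCos M F τ * sin (φ τ)).continuousAt).div
      hRc.continuousAt (hne t ht)) fun t ht => (hderiv t ht).2
  simp only [Pi.div_apply, hφ0, hC₀, hS₀] at hA hB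
  have hcs := sin_sq_add_cos_sq φ₀
  have hcsT := sin_sq_add_cos_sq (φ T)
  have hA' : orderCos M F T * cos (φ T) + orderSin M F T * sin (φ T) = orderNorm M F T := by
    field_simp at hA
    linear_combination hA + orderNorm M F T * hcs
  have hB' : orderSin M F T * cos (φ T) - orderCos M F T * sin (φ T) = 0 := by
    field_simp at hB
    linear_combination hB
  constructor
  · linear_combination cos (φ T) * hA' - sin (φ T) * hB' - orderCos M F T * hcsT
  · linear_combination sin (φ T) * hA' + cos (φ T) * hB' - orderSin M F T * hcsT

end IsMeanField

/-! ### Energy -/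

/-- A smoothed sawtooth: `P` is `2π`-periodic with derivative `1 - q`, where `q` vanishes near the
multiples of `π`. -/
structure IsSawtooth (P q : ℝ → ℝ) (B : ℝ) : Prop where
  pos : 0 < B
  continuous : Continuous q
  hasDerivAt : ∀ x, HasDerivAt P (1 - q x) x
  periodic : Function.Periodic P (2 * π)
  abs_le : ∀ x, |P x| ≤ B
  abs_deriv_le : ∀ x, |q x| ≤ B
  eq_zero : ∀ x, |sin x| ≤ 1 / 2 → q x = 0

theorem exists_isSawtooth : ∃ P q B, IsSawtooth P q B := by
  set r : ℝ → ℝ := fun x => max 0 (sin x ^ 2 - 1 / 4) with hr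
  have hrc : Continuous r := by simp only [hr]; fun_prop
  have hrp : Function.Periodic r (2 * π) := fun x => by simp only [hr, sin_add_two_pi]
  have hI : 0 < ∫ x in (0 : ℝ)..(2 * π), r x := by
    refine intervalIntegral.integral_pos (by positivity) hrc.continuousOn
      (fun x _ => le_max_left _ _) ⟨π / 2, ⟨by positivity, by linarith [pi_pos]⟩, ?_⟩
    simp only [hr, sin_pi_div_two]
    norm_num
  set κ := 2 * π / ∫ x in (0 : ℝ)..(2 * π), r x with hκ
  set q : ℝ → ℝ := fun x => κ * r x with hq
  have hqc : Continuous q := by fun_prop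
  have hqp : Function.Periodic q (2 * π) := fun x => by simp only [hq, hrp x]
  set P : ℝ → ℝ := fun x => ∫ y in (0 : ℝ)..x, (1 - q y) with hP
  have hc : Continuous fun y => 1 - q y := by fun_prop
  have hPd : ∀ x, HasDerivAt P (1 - q x) x := fun x => (hc.integral_hasStrictDerivAt 0 x).hasDerivAt
  have hzero : ∫ y in (0 : ℝ)..(2 * π), (1 - q y) = 0 := by
    rw [intervalIntegral.integral_sub (by simp) (hqc.intervalIntegrable _ _)]
    simp only [hq, intervalIntegral.integral_const_mul, hκ, intervalIntegral.integral_const]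
    field_simp
    simp
  have hPp : Function.Periodic P (2 * π) := by
    intro x
    have hp : Function.Periodic (fun y => 1 - q y) (2 * π) := fun y => by simp only [hqp y]
    have h1 := hp.intervalIntegral_add_eq x 0
    rw [zero_add, hzero] at h1
    simp only [hP]
    rw [← intervalIntegral.integral_add_adjacent_intervals (hc.intervalIntegrable 0 x)
      (hc.intervalIntegrable x (x + 2 * π)), h1, add_zero]
  have hPc : Continuous P := continuous_iff_continuousAt.2 fun x => (hPd x).continuousAt
  have hbound : ∀ g : ℝ → ℝ, Continuous g → Function.Periodic g (2 * π) →
      ∃ B, ∀ x, |g x| ≤ B := by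
    intro g hg hgp
    obtain ⟨B, hB⟩ := (isCompact_Icc (a := (0 : ℝ)) (b := 2 * π)).exists_bound_of_continuousOn
      hg.continuousOn
    refine ⟨B, fun x => ?_⟩
    obtain ⟨y, hy, hxy⟩ := hgp.exists_mem_Ico₀ (by positivity) x
    rw [hxy]
    exact hB y ⟨hy.1, hy.2.le⟩
  obtain ⟨B₁, hB₁⟩ := hbound P hPc hPp
  obtain ⟨B₂, hB₂⟩ := hbound q hqc hqp
  refine ⟨P, q, max 1 (max B₁ B₂), by positivity, hqc, hPd, hPp,
    fun x => (hB₁ x).trans ?_, fun x => (hB₂ x).trans ?_, fun x hx => ?_⟩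
  · simp
  · simp
  · have : sin x ^ 2 ≤ (1 / 2) ^ 2 := sq_le_sq' (abs_le.1 hx).1 (abs_le.1 hx).2
    simp only [hq, hr]
    rw [max_eq_left (by linarith), mul_zero]

/-- Mean natural frequency. -/
def meanFreq (M : ℝ) (F : ℝ × ℝ × ℝ → ℝ) : ℝ :=
  ∫ p in box (-M) M, p.2 * F (p.1, p.2, 0)

/-- Velocity relative to the mean natural frequency. -/
def slip (M K : ℝ) (F : ℝ × ℝ × ℝ → ℝ) (q : ℝ × ℝ × ℝ) : ℝ :=
  speed M K F q - meanFreq M F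

/-- Dissipation: the mean square of `slip`. -/
def dissipation (M K : ℝ) (F : ℝ × ℝ × ℝ → ℝ) (t : ℝ) : ℝ :=
  ∫ p in box (-M) M, slip M K F (p.1, p.2, t) ^ 2 * F (p.1, p.2, t)

/-- Energy: `K/2` times the squared modulus of the order parameter, corrected by the mean of the
relative natural frequency times the sawtooth of the phase. -/
def energy (M K m φ₀ : ℝ) (P : ℝ → ℝ) (F : ℝ × ℝ × ℝ → ℝ) (t : ℝ) : ℝ :=
  K / 2 * (orderCos M F t ^ 2 + orderSin M F t ^ 2)
    + ∫ p in box (-M) M, ((p.2 - meanFreq M F) * P (p.1 - phase M K m φ₀ F t)) * F (p.1, p.2, t)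

namespace IsMeanField

variable {M K : ℝ} {F : ℝ × ℝ × ℝ → ℝ}

theorem average_mono (h : IsMeanField M K F) {χ ψ : ℝ × ℝ → ℝ} (hχ : Continuous χ)
    (hψ : Continuous ψ) (hle : ∀ p ∈ box (-M) M, χ p ≤ ψ p) (t : ℝ) :
    ∫ p in box (-M) M, χ p * F (p.1, p.2, t) ≤ ∫ p in box (-M) M, ψ p * F (p.1, p.2, t) := by
  have hF := h.continuous
  exact setIntegral_mono_on (integrableOn_box (by fun_prop) _ _)
    (integrableOn_box (by fun_prop) _ _) (measurableSet_box _ _)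
    fun p hp => mul_le_mul_of_nonneg_right (hle p hp) (h.nonneg _)

theorem average_const (h : IsMeanField M K F) (B : ℝ) {t : ℝ} (ht : 0 ≤ t) :
    ∫ p in box (-M) M, B * F (p.1, p.2, t) = B := by
  rw [integral_const_mul, h.mass t ht, mul_one]

theorem abs_average_le (h : IsMeanField M K F) {ψ : ℝ × ℝ → ℝ} (hψ : Continuous ψ) {B : ℝ}
    (hle : ∀ p ∈ box (-M) M, |ψ p| ≤ B) {t : ℝ} (ht : 0 ≤ t) :
    |∫ p in box (-M) M, ψ p * F (p.1, p.2, t)| ≤ B := by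
  rw [abs_le]
  constructor
  · rw [← h.average_const (-B) ht]
    exact h.average_mono continuous_const hψ (fun p hp => (abs_le.1 (hle p hp)).1) t
  · refine le_of_le_of_eq ?_ (h.average_const B ht)
    exact h.average_mono hψ continuous_const (fun p hp => (abs_le.1 (hle p hp)).2) t

/-- Jensen's inequality for the square. -/
theorem sq_average_le (h : IsMeanField M K F) {ψ : ℝ × ℝ → ℝ} (hψ : Continuous ψ) {t : ℝ}
    (ht : 0 ≤ t) :
    (∫ p in box (-M) M, ψ p * F (p.1, p.2, t)) ^ 2
      ≤ ∫ p in box (-M) M, ψ p ^ 2 * F (p.1, p.2, t) := by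
  have hF := h.continuous
  set A := ∫ p in box (-M) M, ψ p * F (p.1, p.2, t) with hA
  have h1 := h.average_mono (χ := fun p => 2 * A * ψ p - A ^ 2) (ψ := fun p => ψ p ^ 2)
    (by fun_prop) (by fun_prop) (fun p _ => by nlinarith [sq_nonneg (ψ p - A)]) t
  refine le_trans (le_of_eq ?_) h1
  have h2 : ∀ p : ℝ × ℝ, (2 * A * ψ p - A ^ 2) * F (p.1, p.2, t)
      = 2 * A * (ψ p * F (p.1, p.2, t)) - A ^ 2 * F (p.1, p.2, t) := fun p => by ring
  simp only [h2]
  rw [integral_sub (integrableOn_box (by fun_prop) _ _) (integrableOn_box (by fun_prop) _ _),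
    integral_const_mul, ← hA, h.average_const _ ht]
  ring

theorem orderNorm_le_one (h : IsMeanField M K F) {t : ℝ} (ht : 0 ≤ t) : orderNorm M F t ≤ 1 := by
  have hF := h.continuous
  have h1 := h.sq_average_le (ψ := fun p => cos p.1) (by fun_prop) ht
  have h2 := h.sq_average_le (ψ := fun p => sin p.1) (by fun_prop) ht
  have h3 : (∫ p in box (-M) M, cos p.1 ^ 2 * F (p.1, p.2, t))
      + ∫ p in box (-M) M, sin p.1 ^ 2 * F (p.1, p.2, t) = 1 := by
    rw [← integral_add (integrableOn_box (by fun_prop) _ _) (integrableOn_box (by fun_prop) _ _),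
      ← h.mass t ht]
    refine integral_congr_ae (Eventually.of_forall fun p => ?_)
    simp only
    linear_combination F (p.1, p.2, t) * cos_sq_add_sin_sq p.1
  refine sqrt_le_one.2 ?_
  rw [orderCos, orderSin]
  linarith

theorem abs_component_le (M : ℝ) (F : ℝ × ℝ × ℝ → ℝ) (θ t : ℝ) :
    |sin θ * orderCos M F t - cos θ * orderSin M F t| ≤ orderNorm M F t ∧
    |cos θ * orderCos M F t + sin θ * orderSin M F t| ≤ orderNorm M F t := by
  have h1 := sin_sq_add_cos_sq θ
  constructor
  · refine abs_le_sqrt ?_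
    nlinarith [sq_nonneg (cos θ * orderCos M F t + sin θ * orderSin M F t)]
  · refine abs_le_sqrt ?_
    nlinarith [sq_nonneg (sin θ * orderCos M F t - cos θ * orderSin M F t)]

theorem abs_meanFreq_le (h : IsMeanField M K F) : |meanFreq M F| ≤ M :=
  h.abs_average_le (ψ := fun p => p.2) (by fun_prop) (fun _ hp => abs_le.2 hp.2) le_rfl

theorem abs_relFreq_le (h : IsMeanField M K F) {ω : ℝ} (hω : |ω| ≤ M) :
    |ω - meanFreq M F| ≤ 2 * M := by
  have h1 := abs_sub ω (meanFreq M F)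
  have h2 := h.abs_meanFreq_le
  linarith

theorem abs_speed_le (h : IsMeanField M K F) (hK : 0 ≤ K) (θ : ℝ) {ω t : ℝ} (hω : |ω| ≤ M)
    (ht : 0 ≤ t) : |speed M K F (θ, ω, t)| ≤ M + K := by
  have h1 := (abs_component_le M F θ t).1.trans (h.orderNorm_le_one ht)
  have h2 := abs_sub ω (K * (sin θ * orderCos M F t - cos θ * orderSin M F t))
  rw [abs_mul, abs_of_nonneg hK] at h2
  have h3 := mul_le_mul_of_nonneg_left h1 hK
  simp only [speed]
  linarith

theorem abs_slip_le (h : IsMeanField M K F) (hK : 0 ≤ K) (θ : ℝ) {ω t : ℝ} (hω : |ω| ≤ M)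
    (ht : 0 ≤ t) : |slip M K F (θ, ω, t)| ≤ 2 * M + K := by
  have h1 := h.abs_speed_le hK θ hω ht
  have h2 := abs_sub (speed M K F (θ, ω, t)) (meanFreq M F)
  have h3 := h.abs_meanFreq_le
  simp only [slip]
  linarith

theorem continuous_slip (h : IsMeanField M K F) : Continuous (slip M K F) :=
  h.continuous_speed.sub continuous_const

theorem continuous_dissipation (h : IsMeanField M K F) : Continuous (dissipation M K F) :=
  IsTransported.continuous_integral h.continuous (-M) M (h.continuous_slip.pow 2)

theorem dissipation_nonneg (h : IsMeanField M K F) (t : ℝ) : 0 ≤ dissipation M K F t :=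
  integral_nonneg fun _ => mul_nonneg (sq_nonneg _) (h.nonneg _)

theorem dissipation_le (h : IsMeanField M K F) (hK : 0 ≤ K) {t : ℝ} (ht : 0 ≤ t) :
    dissipation M K F t ≤ (2 * M + K) ^ 2 := by
  have hs := h.continuous_slip
  refine (le_abs_self _).trans (h.abs_average_le
    (ψ := fun p => slip M K F (p.1, p.2, t) ^ 2) (by fun_prop) (fun p hp => ?_) ht)
  rw [abs_pow]
  exact pow_le_pow_left₀ (abs_nonneg _) (h.abs_slip_le hK p.1 (abs_le.2 hp.2) ht) 2

theorem average_relFreq (h : IsMeanField M K F) {t : ℝ} (ht : 0 ≤ t) :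
    ∫ p in box (-M) M, (p.2 - meanFreq M F) * F (p.1, p.2, t) = 0 := by
  have hF := h.continuous
  rw [h.integral_frequency_eq (-M) M (χ := fun ω => ω - meanFreq M F) (by fun_prop) ht]
  simp only [sub_mul]
  rw [integral_sub (integrableOn_box (by fun_prop) _ _) (integrableOn_box (by fun_prop) _ _),
    h.average_const _ le_rfl, meanFreq, sub_self]

theorem average_linear (h : IsMeanField M K F) (a b t : ℝ) :
    ∫ p in box (-M) M, (sin p.1 * a - cos p.1 * b) * F (p.1, p.2, t)
      = a * orderSin M F t - b * orderCos M F t := by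
  have hF := h.continuous
  rw [orderSin, orderCos, ← integral_const_mul, ← integral_const_mul,
    ← integral_sub (integrableOn_box (by fun_prop) _ _) (integrableOn_box (by fun_prop) _ _)]
  refine integral_congr_ae (Eventually.of_forall fun p => ?_)
  simp only
  ring

/-- The order parameter rotates at the mean natural frequency, up to an error controlled by the
dissipation. -/
theorem sq_phaseSpeed_sub_le (h : IsMeanField M K F) {m t : ℝ} (hm : 0 < m) (ht : 0 ≤ t)
    (hR : m ≤ orderNorm M F t) :
    m ^ 2 * (phaseSpeed M K m F t - meanFreq M F) ^ 2 ≤ dissipation M K F t := by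
  have hF := h.continuous
  have hs := h.continuous_slip
  have hv := h.continuous_speed
  have hsq := orderNorm_sq M F t
  have hle : m ^ 2 ≤ orderNorm M F t ^ 2 := by gcongr
  set R := orderNorm M F t with hRdef
  have hpos : 0 < R ^ 2 := lt_of_lt_of_le (by positivity) hle
  set J := ∫ p in box (-M) M, ((cos p.1 * orderCos M F t + sin p.1 * orderSin M F t)
    * slip M K F (p.1, p.2, t)) * F (p.1, p.2, t) with hJ
  have h1 : J = R ^ 2 * (phaseSpeed M K m F t - meanFreq M F) := by
    have e1 : R ^ 2 * phaseSpeed M K m F t = orderCos M F t * orderSinDeriv M K F t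
        - orderSin M F t * orderCosDeriv M K F t := by
      rw [phaseSpeed, ← hsq, max_eq_left hle, mul_div_cancel₀ _ hpos.ne']
    have e2 := h.average_linear (orderSin M F t) (-orderCos M F t) t
    rw [mul_sub, e1, hsq, orderSinDeriv, orderCosDeriv, ← integral_const_mul,
      ← integral_const_mul,
      ← integral_sub (integrableOn_box (by fun_prop) _ _) (integrableOn_box (by fun_prop) _ _)]
    have e3 : (orderCos M F t ^ 2 + orderSin M F t ^ 2) * meanFreq M F
        = ∫ p in box (-M) M, meanFreq M F * ((sin p.1 * orderSin M F t
          - cos p.1 * (-orderCos M F t)) * F (p.1, p.2, t)) := by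
      rw [integral_const_mul, e2]
      ring
    rw [e3, ← integral_sub (integrableOn_box (by fun_prop) _ _)
      (integrableOn_box (by fun_prop) _ _), hJ]
    refine integral_congr_ae (Eventually.of_forall fun p => ?_)
    simp only [slip]
    ring
  have h2 : J ^ 2 ≤ R ^ 2 * dissipation M K F t := by
    refine (h.sq_average_le (ψ := fun p => (cos p.1 * orderCos M F t + sin p.1 * orderSin M F t)
      * slip M K F (p.1, p.2, t)) (by fun_prop) ht).trans ?_
    have h3 := h.average_mono
      (χ := fun p => ((cos p.1 * orderCos M F t + sin p.1 * orderSin M F t)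
        * slip M K F (p.1, p.2, t)) ^ 2)
      (ψ := fun p => R ^ 2 * slip M K F (p.1, p.2, t) ^ 2)
      (by fun_prop) (by fun_prop) (fun p _ => ?_) t
    · refine h3.trans (le_of_eq ?_)
      simp only [mul_assoc]
      rw [integral_const_mul]
      rfl
    · rw [mul_pow]
      refine mul_le_mul_of_nonneg_right ?_ (sq_nonneg _)
      rw [← sq_abs]
      exact pow_le_pow_left₀ (abs_nonneg _) (abs_component_le M F p.1 t).2 2
  rw [h1, mul_pow, sq (R ^ 2), mul_assoc] at h2
  exact (mul_le_mul_of_nonneg_right hle (sq_nonneg _)).trans (le_of_mul_le_mul_left h2 hpos)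

end IsMeanField

/-! ### Persistence of coherence and decay of the dissipation -/

/-- The coupling strength `K` is large compared with the frequency bound `M`, for a lower bound `m`
of the order parameter and a sawtooth bound `B`. -/
structure IsStrong (M K m B : ℝ) : Prop where
  freq_pos : 0 < M
  coupling_pos : 0 < K
  bound_pos : 0 < m
  two_freq_le : 2 * M ≤ K
  freq_le : 8 * M ≤ K * m
  absorb : 16 * M * B * (1 + 8 / m ^ 2) ≤ K * m
  gap : 4 * M * B < K * m ^ 2

/-- The error made by the sawtooth is absorbed by the dissipation: where `q ≠ 0`, the slip `u` has
size at least `K * m / 4`. -/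
theorem sawtooth_error_le {M K m B ν q u e : ℝ} (hs : IsStrong M K m B) (hν : |ν| ≤ 2 * M)
    (hq : |q| ≤ B) (hqu : q = 0 ∨ K * m / 4 ≤ |u|) (he : |e| ≤ 2 * K / m) :
    ν * q * (u - e) ≤ u ^ 2 / 2 := by
  have hM := hs.freq_pos
  have hK := hs.coupling_pos
  have hm := hs.bound_pos
  rcases hqu with rfl | hu
  · simp only [mul_zero, zero_mul]
    positivity
  have hB : 0 ≤ B := (abs_nonneg q).trans hq
  have hKm : 0 < K * m := by positivity
  have he' : |e| ≤ 8 / m ^ 2 * |u| := by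
    calc |e| ≤ 2 * K / m := he
      _ = 8 / m ^ 2 * (K * m / 4) := by field_simp; norm_num
      _ ≤ 8 / m ^ 2 * |u| := by gcongr
  have h1 : |u - e| ≤ (1 + 8 / m ^ 2) * |u| := by
    have := abs_sub u e
    linarith
  calc ν * q * (u - e) ≤ |ν * q * (u - e)| := le_abs_self _
    _ = |ν| * |q| * |u - e| := by rw [abs_mul, abs_mul]
    _ ≤ 2 * M * B * ((1 + 8 / m ^ 2) * |u|) := by gcongr
    _ = (16 * M * B * (1 + 8 / m ^ 2)) * |u| / 8 := by ring
    _ ≤ (K * m) * |u| / 8 := by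
      have := mul_le_mul_of_nonneg_right hs.absorb (abs_nonneg u)
      linarith
    _ = (K * m / 4) * |u| / 2 := by ring
    _ ≤ |u| * |u| / 2 := by gcongr
    _ = u ^ 2 / 2 := by rw [abs_mul_abs_self]; ring

/-- A continuous function with nonnegative derivative on an open interval takes ordered values at
its endpoints. -/
theorem le_of_hasDerivAt_nonneg {X : ℝ → ℝ} {a b : ℝ} (hab : a ≤ b)
    (hc : ContinuousOn X (Icc a b)) (hd : ∀ t ∈ Ioo a b, ∃ E, HasDerivAt X E t ∧ 0 ≤ E) :
    X a ≤ X b := by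
  rcases hab.eq_or_lt with rfl | hab'
  · rfl
  obtain ⟨τ, hτ, hs⟩ := exists_hasDerivAt_eq_slope X (deriv X) hab' hc fun t ht => by
    obtain ⟨E, hE, -⟩ := hd t ht
    exact hE.differentiableAt.hasDerivAt
  obtain ⟨E, hE, h1⟩ := hd τ hτ
  rw [← hE.deriv, hs, le_div_iff₀ (by linarith), zero_mul] at h1
  linarith

namespace IsMeanField

variable {M K : ℝ} {F : ℝ × ℝ × ℝ → ℝ}

theorem abs_phaseSpeed_sub_le (h : IsMeanField M K F) {m B t : ℝ} (hs : IsStrong M K m B)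
    (ht : 0 ≤ t) (hR : m ≤ orderNorm M F t) :
    |phaseSpeed M K m F t - meanFreq M F| ≤ 2 * K / m := by
  have hm := hs.bound_pos
  have hK := hs.coupling_pos
  have hM := hs.freq_pos
  have h1 := (h.sq_phaseSpeed_sub_le hm ht hR).trans (h.dissipation_le hK.le ht)
  rw [← mul_pow] at h1
  have h2 := abs_le_of_sq_le_sq h1 (by positivity)
  rw [abs_mul, abs_of_pos hm] at h2
  rw [le_div_iff₀ hm]
  linarith [hs.two_freq_le]

theorem continuous_energy (h : IsMeanField M K F) {m φ₀ B : ℝ} {P q : ℝ → ℝ}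
    (hP : IsSawtooth P q B) (hm : 0 < m) : Continuous (energy M K m φ₀ P F) := by
  have h1 := h.continuous_orderCos
  have h2 := h.continuous_orderSin
  have h3 := h.continuous_phase hm φ₀
  have h4 : Continuous P := continuous_iff_continuousAt.2 fun x => (hP.hasDerivAt x).continuousAt
  exact ((by fun_prop : Continuous fun t =>
    K / 2 * (orderCos M F t ^ 2 + orderSin M F t ^ 2))).add
    (IsTransported.continuous_integral h.continuous (-M) M
      (ψ := fun q => (q.2.1 - meanFreq M F) * P (q.1 - phase M K m φ₀ F q.2.2)) (by fun_prop))

theorem abs_energy_sub_le (h : IsMeanField M K F) {m φ₀ B : ℝ} {P q : ℝ → ℝ}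
    (hP : IsSawtooth P q B) (hM : 0 < M) {t : ℝ} (ht : 0 ≤ t) :
    |energy M K m φ₀ P F t - K / 2 * orderNorm M F t ^ 2| ≤ 2 * M * B := by
  have hc : Continuous P := continuous_iff_continuousAt.2 fun x => (hP.hasDerivAt x).continuousAt
  rw [orderNorm_sq, energy, add_sub_cancel_left]
  refine h.abs_average_le (ψ := fun p => (p.2 - meanFreq M F) * P (p.1 - phase M K m φ₀ F t))
    (by fun_prop) (fun p hp => ?_) ht
  rw [abs_mul]
  exact mul_le_mul (h.abs_relFreq_le (abs_le.2 hp.2)) (hP.abs_le _) (abs_nonneg _) (by positivity)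

/-- The energy grows at least at half the rate of the dissipation. -/
theorem hasDerivAt_energy (h : IsMeanField M K F) {m φ₀ B : ℝ} {P q : ℝ → ℝ}
    (hP : IsSawtooth P q B) (hs : IsStrong M K m B) {t : ℝ} (ht : 0 < t)
    (hR : m ≤ orderNorm M F t)
    (hC : orderCos M F t = orderNorm M F t * cos (phase M K m φ₀ F t))
    (hS : orderSin M F t = orderNorm M F t * sin (phase M K m φ₀ F t)) :
    ∃ E, HasDerivAt (energy M K m φ₀ P F) E t ∧ dissipation M K F t / 2 ≤ E := by
  have hm := hs.bound_pos
  have hK := hs.coupling_pos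
  have hM := hs.freq_pos
  have hF := h.continuous
  have hφc := h.continuous_phase hm φ₀
  have hφs := h.continuous_phaseSpeed hm
  have hqc := hP.continuous
  have hPc : Continuous P := continuous_iff_continuousAt.2 fun x => (hP.hasDerivAt x).continuousAt
  have hv := h.continuous_speed
  have hu := h.continuous_slip
  have hd := h.hasDerivAt_average
    (ψ := fun z => (z.2.1 - meanFreq M F) * P (z.1 - phase M K m φ₀ F z.2.2))
    (ψθ := fun z => (z.2.1 - meanFreq M F) * (1 - q (z.1 - phase M K m φ₀ F z.2.2)))
    (ψt := fun z => (z.2.1 - meanFreq M F) * ((1 - q (z.1 - phase M K m φ₀ F z.2.2))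
      * (-phaseSpeed M K m F z.2.2)))
    (by fun_prop) (by fun_prop) (by fun_prop)
    (fun θ ω τ => ((hP.hasDerivAt _).comp_sub_const θ (phase M K m φ₀ F τ)).const_mul (ω - meanFreq M F))
    (fun θ ω τ _ => (((hP.hasDerivAt _).comp τ
      ((h.hasDerivAt_phase_time hm φ₀ τ).const_sub θ)).const_mul (ω - meanFreq M F)))
    (fun ω τ θ => by
      simp only
      rw [add_sub_right_comm, hP.periodic]) ht
  have hCd := h.hasDerivAt_orderCos ht
  have hSd := h.hasDerivAt_orderSin ht
  have hH := (((hCd.pow 2).add (hSd.pow 2)).const_mul (K / 2)).add hd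
  refine ⟨_, hH, ?_⟩
  simp only at hd
  set ω₀ := meanFreq M F with hω₀
  set e := phaseSpeed M K m F t - ω₀ with he
  have heb : |e| ≤ 2 * K / m := h.abs_phaseSpeed_sub_le hs ht.le hR
  -- Two vanishing averages: they account for the mean frequency and for the rotation of the phase.
  have hlin := h.average_linear (orderCos M F t) (orderSin M F t) t
  have hrel := h.average_relFreq ht.le
  rw [← hω₀] at hrel
  have hquad : K / 2 * (2 * orderCos M F t * orderCosDeriv M K F t
      + 2 * orderSin M F t * orderSinDeriv M K F t)
      = ∫ p in box (-M) M, -(K * (sin p.1 * orderCos M F t - cos p.1 * orderSin M F t))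
        * speed M K F (p.1, p.2, t) * F (p.1, p.2, t) := by
    rw [orderCosDeriv, orderSinDeriv, ← integral_const_mul, ← integral_const_mul,
      ← integral_add (integrableOn_box (by fun_prop) _ _) (integrableOn_box (by fun_prop) _ _),
      ← integral_const_mul]
    refine integral_congr_ae (Eventually.of_forall fun p => ?_)
    simp only
    ring
  have hpt : ∀ p ∈ box (-M) M, slip M K F (p.1, p.2, t) ^ 2 / 2
      ≤ slip M K F (p.1, p.2, t) ^ 2 - (p.2 - ω₀) * q (p.1 - phase M K m φ₀ F t)
        * (slip M K F (p.1, p.2, t) - e) := by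
    intro p hp
    have hν := h.abs_relFreq_le (abs_le.2 hp.2)
    have := sawtooth_error_le (u := slip M K F (p.1, p.2, t)) hs hν
      (hP.abs_deriv_le (p.1 - phase M K m φ₀ F t)) ?_ heb
    · linarith
    by_cases hsin : |sin (p.1 - phase M K m φ₀ F t)| ≤ 1 / 2
    · exact Or.inl (hP.eq_zero _ hsin)
    right
    push Not at hsin
    have hg : slip M K F (p.1, p.2, t) = (p.2 - ω₀)
        - K * orderNorm M F t * sin (p.1 - phase M K m φ₀ F t) := by
      simp only [slip, speed]
      rw [sin_sub, hC, hS]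
      ring
    have h1 := abs_sub_abs_le_abs_sub (K * orderNorm M F t * sin (p.1 - phase M K m φ₀ F t))
      (p.2 - ω₀)
    have hRp : 0 ≤ K * orderNorm M F t := mul_nonneg hK.le (hm.le.trans hR)
    rw [abs_sub_comm (K * orderNorm M F t * _), ← hg, abs_mul, abs_of_nonneg hRp] at h1
    rw [← hω₀] at hν
    have h2 : K * m * (1 / 2) ≤ K * orderNorm M F t * |sin (p.1 - phase M K m φ₀ F t)| := by
      gcongr
    have h3 := hs.freq_le
    linarith
  have hmono := h.average_mono (χ := fun p => slip M K F (p.1, p.2, t) ^ 2 / 2)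
    (ψ := fun p => slip M K F (p.1, p.2, t) ^ 2 - (p.2 - ω₀)
      * q (p.1 - phase M K m φ₀ F t) * (slip M K F (p.1, p.2, t) - e))
    (by fun_prop) (by fun_prop) hpt t
  have hD : dissipation M K F t / 2
      = ∫ p in box (-M) M, slip M K F (p.1, p.2, t) ^ 2 / 2 * F (p.1, p.2, t) := by
    rw [dissipation, ← integral_div]
    refine integral_congr_ae (Eventually.of_forall fun p => ?_)
    simp only
    ring
  rw [hD]
  refine hmono.trans (le_of_eq ?_)
  have hlin' : ∫ p in box (-M) M, (ω₀ * K) * ((sin p.1 * orderCos M F t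
      - cos p.1 * orderSin M F t) * F (p.1, p.2, t)) = 0 := by
    rw [integral_const_mul, hlin]
    ring
  have hrel' : ∫ p in box (-M) M, e * ((p.2 - ω₀) * F (p.1, p.2, t)) = 0 := by
    rw [integral_const_mul, hrel, mul_zero]
  have hpow : K / 2 * (((2 : ℕ) : ℝ) * orderCos M F t ^ (2 - 1) * orderCosDeriv M K F t
      + ((2 : ℕ) : ℝ) * orderSin M F t ^ (2 - 1) * orderSinDeriv M K F t)
      = K / 2 * (2 * orderCos M F t * orderCosDeriv M K F t
      + 2 * orderSin M F t * orderSinDeriv M K F t) := by norm_num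
  have hsum : ∀ {a b : ℝ × ℝ → ℝ}, Continuous a → Continuous b →
      (∫ p in box (-M) M, a p) + ∫ p in box (-M) M, b p = ∫ p in box (-M) M, (a p + b p) :=
    fun ha hb => (integral_add (integrableOn_box ha _ _) (integrableOn_box hb _ _)).symm
  rw [hpow, hquad, ← add_zero ((∫ p in box (-M) M, _) + ∫ p in box (-M) M, _),
    ← add_zero (0 : ℝ)]
  nth_rewrite 1 [← hlin']
  nth_rewrite 1 [← hrel']
  rw [hsum (by fun_prop) (by fun_prop), hsum (by fun_prop) (by fun_prop),
    hsum (by fun_prop) (by fun_prop)]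
  refine integral_congr_ae (Eventually.of_forall fun p => ?_)
  simp only [slip, speed, he, hω₀]
  ring

theorem exists_phase (M : ℝ) (F : ℝ × ℝ × ℝ → ℝ) (t : ℝ) :
    ∃ φ₀, orderCos M F t = orderNorm M F t * cos φ₀ ∧
      orderSin M F t = orderNorm M F t * sin φ₀ := by
  set z : ℂ := ⟨orderCos M F t, orderSin M F t⟩ with hz
  have hn : ‖z‖ = orderNorm M F t := by
    rw [Complex.norm_eq_sqrt_sq_add_sq, orderNorm]
  exact ⟨Complex.arg z, by rw [← hn, Complex.norm_mul_cos_arg],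
    by rw [← hn, Complex.norm_mul_sin_arg]⟩

/-- For strong coupling the order parameter never drops below half its initial modulus: up to the
first time at which it does, the energy is nondecreasing. -/
theorem le_orderNorm (h : IsMeanField M K F) {m B : ℝ} {P q : ℝ → ℝ} (hP : IsSawtooth P q B)
    (hs : IsStrong M K m B) (hR₀ : orderNorm M F 0 = 2 * m) {t : ℝ} (ht : 0 ≤ t) :
    m ≤ orderNorm M F t := by
  have hm := hs.bound_pos
  have hK := hs.coupling_pos
  have hRc := h.continuous_orderNorm
  by_contra! hlt
  obtain ⟨T, ⟨⟨hT0, -⟩, hTm⟩, hleast⟩ :=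
    (isCompact_Icc.inter_right (isClosed_le hRc continuous_const) :
      IsCompact (Icc 0 t ∩ {τ | orderNorm M F τ ≤ m})).exists_isLeast
      ⟨t, ⟨ht, le_rfl⟩, hlt.le⟩
  replace hTm : orderNorm M F T ≤ m := hTm
  have hTpos : 0 < T := hT0.lt_of_ne (by rintro rfl; linarith)
  have hbefore : ∀ τ ∈ Ico 0 T, m ≤ orderNorm M F τ := by
    intro τ hτ
    by_contra! hτm
    have hτt : τ ≤ t := by
      by_contra! htτ
      have := hleast ⟨⟨ht, le_rfl⟩, hlt.le⟩
      linarith [hτ.2]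
    exact absurd (hleast ⟨⟨hτ.1, hτt⟩, hτm.le⟩) (not_le.2 hτ.2)
  have hon : ∀ τ ∈ Icc 0 T, m ≤ orderNorm M F τ := by
    have hcl : Icc 0 T ⊆ {τ | m ≤ orderNorm M F τ} := by
      rw [← closure_Ico hTpos.ne]
      exact closure_minimal hbefore (isClosed_le continuous_const hRc)
    exact fun τ hτ => hcl hτ
  obtain ⟨φ₀, hC₀, hS₀⟩ := exists_phase M F 0
  have hE : energy M K m φ₀ P F 0 ≤ energy M K m φ₀ P F T := by
    refine le_of_hasDerivAt_nonneg hT0 (h.continuous_energy hP hm).continuousOn fun τ hτ => ?_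
    obtain ⟨hC, hS⟩ := h.orderCos_orderSin_eq hm hτ.1.le
      (fun σ hσ => hon σ ⟨hσ.1, hσ.2.trans hτ.2.le⟩) hC₀ hS₀
    obtain ⟨E, hE, hle⟩ := h.hasDerivAt_energy hP hs hτ.1 (hon τ ⟨hτ.1.le, hτ.2.le⟩) hC hS
    exact ⟨E, hE, by linarith [h.dissipation_nonneg (K := K) τ]⟩
  have h0 := abs_le.1 (h.abs_energy_sub_le (m := m) (φ₀ := φ₀) (K := K) hP hs.freq_pos le_rfl)
  have h1 := abs_le.1 (h.abs_energy_sub_le (m := m) (φ₀ := φ₀) (K := K) hP hs.freq_pos hT0)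
  rw [hR₀] at h0
  have h2 : K / 2 * orderNorm M F T ^ 2 ≤ K / 2 * m ^ 2 := by
    have : 0 ≤ orderNorm M F T := sqrt_nonneg _
    gcongr
  nlinarith [hs.gap, h0.1, h1.2, mul_pos hK (pow_pos hm 2)]

/-- The dissipation is Lipschitz from below. -/
theorem exists_dissipation_lipschitz (h : IsMeanField M K F) (hM : 0 < M) (hK : 0 < K) :
    ∃ L, 0 < L ∧ ∀ a b, 0 ≤ a → a ≤ b →
      dissipation M K F a - L * (b - a) ≤ dissipation M K F b := by
  have hF := h.continuous
  have hC := h.continuous_orderCos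
  have hS := h.continuous_orderSin
  have hC' := h.continuous_orderCosDeriv
  have hS' := h.continuous_orderSinDeriv
  have hu := h.continuous_slip
  have hv := h.continuous_speed
  set L := 2 * (2 * M + K) * (K * (2 * (M + K))) + (M + K) * (2 * (2 * M + K) * K) with hL
  refine ⟨L, by positivity, fun a b ha hab => ?_⟩
  have key : dissipation M K F a + L * a ≤ dissipation M K F b + L * b := by
    refine le_of_hasDerivAt_nonneg (X := fun t => dissipation M K F t + L * t) hab
      ((h.continuous_dissipation.add (by fun_prop)).continuousOn) fun t ht => ?_
    have ht0 : 0 < t := ha.trans_lt ht.1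
    have hd := h.hasDerivAt_average (ψ := fun z => slip M K F z ^ 2)
      (ψθ := fun z => 2 * slip M K F z *
        -(K * (cos z.1 * orderCos M F z.2.2 + sin z.1 * orderSin M F z.2.2)))
      (ψt := fun z => 2 * slip M K F z *
        -(K * (sin z.1 * orderCosDeriv M K F z.2.2 - cos z.1 * orderSinDeriv M K F z.2.2)))
      (by fun_prop) (by fun_prop) (by fun_prop)
      (fun θ ω τ => by
        refine (((IsTransported.hasDerivAt_velocity K ω (orderCos M F τ) (orderSin M F τ)
          θ).sub_const (meanFreq M F)).pow 2).congr_deriv ?_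
        simp [slip, speed])
      (fun θ ω τ hτ => by
        refine ((((((h.hasDerivAt_orderCos hτ).const_mul (sin θ)).sub
          ((h.hasDerivAt_orderSin hτ).const_mul (cos θ))).const_mul K).const_sub
          ω).sub_const (meanFreq M F)).pow 2 |>.congr_deriv ?_
        simp [slip, speed])
      (fun ω τ θ => by simp only [slip, speed, sin_add_two_pi, cos_add_two_pi]) ht0
    refine ⟨_, hd.add ((hasDerivAt_id t).const_mul L), ?_⟩
    have hCb : |orderCosDeriv M K F t| ≤ M + K := by
      refine h.abs_average_le (ψ := fun p => -(sin p.1 * speed M K F (p.1, p.2, t)))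
        (by fun_prop) (fun p hp => ?_) ht0.le
      rw [abs_neg, abs_mul]
      exact (mul_le_of_le_one_left (abs_nonneg _) (abs_sin_le_one _)).trans
        (h.abs_speed_le hK.le p.1 (abs_le.2 hp.2) ht0.le)
    have hSb : |orderSinDeriv M K F t| ≤ M + K := by
      refine h.abs_average_le (ψ := fun p => cos p.1 * speed M K F (p.1, p.2, t))
        (by fun_prop) (fun p hp => ?_) ht0.le
      rw [abs_mul]
      exact (mul_le_of_le_one_left (abs_nonneg _) (abs_cos_le_one _)).trans
        (h.abs_speed_le hK.le p.1 (abs_le.2 hp.2) ht0.le)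
    have hbound := h.abs_average_le (ψ := fun p => 2 * slip M K F (p.1, p.2, t) *
        -(K * (sin p.1 * orderCosDeriv M K F t - cos p.1 * orderSinDeriv M K F t))
        + speed M K F (p.1, p.2, t) * (2 * slip M K F (p.1, p.2, t) *
          -(K * (cos p.1 * orderCos M F t + sin p.1 * orderSin M F t)))) (B := L)
      (by fun_prop) (fun p hp => ?_) ht0.le
    · have := (abs_le.1 hbound).1
      simp only [mul_one]
      linarith
    · have hup := h.abs_slip_le hK.le p.1 (abs_le.2 hp.2) ht0.le
      have hvp := h.abs_speed_le hK.le p.1 (abs_le.2 hp.2) ht0.le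
      have hcomp := (abs_component_le M F p.1 t).2.trans (h.orderNorm_le_one ht0.le)
      have hcomp' : |sin p.1 * orderCosDeriv M K F t - cos p.1 * orderSinDeriv M K F t|
          ≤ 2 * (M + K) := by
        refine (abs_sub _ _).trans ?_
        rw [abs_mul, abs_mul]
        have e1 := mul_le_of_le_one_left (abs_nonneg (orderCosDeriv M K F t))
          (abs_sin_le_one p.1)
        have e2 := mul_le_of_le_one_left (abs_nonneg (orderSinDeriv M K F t))
          (abs_cos_le_one p.1)
        linarith
      refine (abs_add_le _ _).trans (add_le_add ?_ ?_)
      · rw [abs_mul, abs_mul, abs_neg, abs_mul, abs_two, abs_of_pos hK]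
        gcongr
      · rw [abs_mul, abs_mul, abs_mul, abs_neg, abs_mul, abs_two, abs_of_pos hK]
        have e3 : K * |cos p.1 * orderCos M F t + sin p.1 * orderSin M F t| ≤ K :=
          mul_le_of_le_one_right hK.le hcomp
        gcongr
  linarith

/-- The dissipation tends to zero: it is Lipschitz, and its integral is bounded by the total
variation of the energy. -/
theorem tendsto_dissipation (h : IsMeanField M K F) {m B φ₀ : ℝ} {P q : ℝ → ℝ}
    (hP : IsSawtooth P q B) (hs : IsStrong M K m B)
    (hR : ∀ t, 0 ≤ t → m ≤ orderNorm M F t)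
    (hpolar : ∀ t, 0 ≤ t → orderCos M F t = orderNorm M F t * cos (phase M K m φ₀ F t) ∧
      orderSin M F t = orderNorm M F t * sin (phase M K m φ₀ F t)) :
    Tendsto (dissipation M K F) atTop (𝓝 0) := by
  have hm := hs.bound_pos
  have hK := hs.coupling_pos
  obtain ⟨L, hL, hlip⟩ := h.exists_dissipation_lipschitz hs.freq_pos hK
  set H := energy M K m φ₀ P F with hH
  have hHc : Continuous H := h.continuous_energy hP hm
  have hHd : ∀ t, 0 < t → ∃ E, HasDerivAt H E t ∧ dissipation M K F t / 2 ≤ E := fun t ht =>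
    h.hasDerivAt_energy hP hs ht (hR t ht.le) (hpolar t ht.le).1 (hpolar t ht.le).2
  have hmono : ∀ a b, 0 ≤ a → a ≤ b → H a ≤ H b := fun a b ha hab =>
    le_of_hasDerivAt_nonneg hab hHc.continuousOn fun t ht => by
      obtain ⟨E, hE, hle⟩ := hHd t (ha.trans_lt ht.1)
      exact ⟨E, hE, by linarith [h.dissipation_nonneg (K := K) t]⟩
  have hbdd : BddAbove (H '' Ici 0) := by
    refine ⟨K / 2 + 2 * M * B, ?_⟩
    rintro _ ⟨t, ht, rfl⟩
    have h1 := (abs_le.1 (h.abs_energy_sub_le (m := m) (φ₀ := φ₀) (K := K) hP hs.freq_pos ht)).2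
    have h2 : K / 2 * orderNorm M F t ^ 2 ≤ K / 2 :=
      mul_le_of_le_one_right (by positivity) (pow_le_one₀ (sqrt_nonneg _) (h.orderNorm_le_one ht))
    linarith
  rw [Metric.tendsto_atTop]
  intro η hη
  -- The dissipation stays above `η / 2` for a time `σ` after exceeding `η`.
  set σ := η / (2 * L) with hσ
  have hσpos : 0 < σ := by positivity
  have hLσ : L * σ = η / 2 := by
    rw [hσ]
    field_simp
  obtain ⟨_, ⟨t₀, ht₀, rfl⟩, hlt⟩ := exists_lt_of_lt_csSup (⟨_, 0, self_mem_Ici, rfl⟩ :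
    (H '' Ici 0).Nonempty) (sub_lt_self (sSup (H '' Ici 0)) (by positivity : 0 < η / 4 * σ))
  refine ⟨t₀, fun t ht => ?_⟩
  have ht0 : 0 ≤ t := le_trans ht₀ ht
  rw [dist_zero_right, norm_of_nonneg (h.dissipation_nonneg t)]
  by_contra! hge
  have hgain : H t - η / 4 * t ≤ H (t + σ) - η / 4 * (t + σ) := by
    refine le_of_hasDerivAt_nonneg (X := fun x => H x - η / 4 * x) (by linarith)
      (hHc.sub (by fun_prop)).continuousOn fun x hx => ?_
    obtain ⟨E, hE, hle⟩ := hHd x (ht0.trans_lt hx.1)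
    refine ⟨_, hE.sub ((hasDerivAt_id x).const_mul (η / 4)), ?_⟩
    have h1 := hlip t x ht0 hx.1.le
    have h2 : L * (x - t) ≤ L * σ := by
      have := hx.2
      gcongr
      linarith
    linarith
  have h1 := hmono t₀ t ht₀ ht
  have h2 := le_csSup hbdd ⟨t + σ, add_nonneg ht0 hσpos.le, rfl⟩
  linarith

end IsMeanField

/-! ### Decay away from the average phase -/

/-- The eighth power of the positive part of `κ - cos x`, a weight supported away from `x = 0`. -/
def weight (κ x : ℝ) : ℝ :=
  max (κ - cos x) 0 ^ 8

theorem hasDerivAt_weight (κ x : ℝ) :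
    HasDerivAt (weight κ) (8 * max (κ - cos x) 0 ^ 7 * sin x) x := by
  have hd : HasDerivAt (fun y => κ - cos y) (sin x) x := by
    simpa using (Real.hasDerivAt_cos x).const_sub κ
  have hpos : ∀ y : ℝ, HasDerivAt (fun z : ℝ => max z 0 ^ 8) (8 * max y 0 ^ 7) y := by
    intro y
    rcases lt_trichotomy y 0 with hy | rfl | hy
    · rw [max_eq_right hy.le]
      refine ((hasDerivAt_const y (0 : ℝ)).congr_of_eventuallyEq ?_).congr_deriv (by norm_num)
      filter_upwards [eventually_lt_nhds hy] with z hz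
      rw [max_eq_right hz.le]
      norm_num
    · rw [hasDerivAt_iff_isLittleO_nhds_zero]
      simp only [max_self, zero_add, ne_eq, OfNat.ofNat_ne_zero, not_false_eq_true, zero_pow,
        sub_zero, mul_zero, smul_zero]
      have h1 : (fun z : ℝ => max z 0 ^ 8) =O[𝓝 0] fun z => z ^ 8 :=
        Asymptotics.isBigO_of_le _ fun z => by
          rw [norm_pow, norm_pow]
          refine pow_le_pow_left₀ (norm_nonneg _) ?_ 8
          rw [norm_of_nonneg (le_max_right z 0)]
          exact max_le (le_abs_self z) (abs_nonneg z)
      exact h1.trans_isLittleO (by simpa using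
        Asymptotics.isLittleO_pow_id (𝕜 := ℝ) (n := 8) (by norm_num))
    · rw [max_eq_left hy.le]
      have := hasDerivAt_pow 8 y
      refine (this.congr_of_eventuallyEq ?_).congr_deriv (by norm_num)
      filter_upwards [eventually_gt_nhds hy] with z hz
      rw [max_eq_left hz.le]
  exact (hpos (κ - cos x)).comp x hd

theorem weight_nonneg (κ x : ℝ) : 0 ≤ weight κ x :=
  pow_nonneg (le_max_right _ _) _

theorem weight_le {κ : ℝ} (hκ : κ ≤ 1) (x : ℝ) : weight κ x ≤ 2 ^ 8 := by
  refine pow_le_pow_left₀ (le_max_right _ _) (max_le ?_ (by norm_num)) 8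
  linarith [neg_one_le_cos x]

/-- Rate inequality behind the decay of `F * weight` along characteristics. Here `c` and `s` are
the cosine and sine of the phase relative to the average phase, `G` is the product of the coupling
strength and the order parameter, and `β` collects the natural frequency and the rotation of the
average phase. The factor `8` is the exponent of the weight: it makes the contraction term
`8 * G * s ^ 2` dominate the growth rate `G * c` of the density where `c` is positive. -/
theorem rate_le {M K m G β c s : ℝ} (hM : 0 < M) (hK : 0 < K) (hm : 0 < m) (hm1 : m ≤ 1)
    (hKm : 576 * M ≤ K * m ^ 2) (hG : K * m ≤ G) (hβ : |β| ≤ 3 * M) (hcs : s ^ 2 + c ^ 2 = 1)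
    (hc : c < 1 - M / K / 8) :
    8 * s * (β - G * s) + G * c * (1 - M / K / 8 - c)
      ≤ -(K * m / 4) * (1 - M / K / 8 - c) := by
  have hKm' : 576 * M ≤ K * m := by
    have : K * m ^ 2 ≤ K * m := by nlinarith
    linarith
  have hKm0 : 0 < K * m := by positivity
  have hG0 : 0 < G := hKm0.trans_le hG
  have ha : 0 < M / K := by positivity
  have ha1 : M / K ≤ 1 := by
    rw [div_le_one hK]
    nlinarith
  set w := 1 - M / K / 8 - c with hw
  have hw0 : 0 < w := by linarith
  have hsβ : s * β ≤ 3 * M * |s| := by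
    calc s * β ≤ |s * β| := le_abs_self _
      _ = |β| * |s| := by rw [abs_mul, mul_comm]
      _ ≤ 3 * M * |s| := by gcongr
  have hss : |s| ^ 2 = s ^ 2 := sq_abs s
  rcases le_total (-(1 / 2)) c with hc2 | hc2
  -- Away from the antipode, `G * |s|` beats `β`, and `s ^ 2` is at least `w / 2`.
  · have hs2 : (1 - c) / 2 ≤ s ^ 2 := by nlinarith
    have hsa : M / K / 16 ≤ s ^ 2 := by linarith
    have h6 : 6 * M ≤ G * |s| := by
      refine le_of_sq_le_sq ?_ (by positivity)
      have e1 : (K * m) ^ 2 * (M / K / 16) ≤ (G * |s|) ^ 2 := by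
        rw [mul_pow G, hss]
        gcongr
      have e2 : (K * m) ^ 2 * (M / K / 16) = (K * m ^ 2) * M / 16 := by
        field_simp
      have e3 : 576 * M * M ≤ K * m ^ 2 * M := by gcongr
      linarith
    have h7 : 3 * M * |s| ≤ G * s ^ 2 / 2 := by
      have := mul_le_mul_of_nonneg_right h6 (abs_nonneg s)
      rw [mul_assoc G, ← sq, hss] at this
      linarith
    have h8 : G * (w / 2) ≤ G * s ^ 2 := by
      refine mul_le_mul_of_nonneg_left ?_ hG0.le
      linarith
    have h9 : G * c * w ≤ G * w := by
      have : G * w * c ≤ G * w * 1 := mul_le_mul_of_nonneg_left (by linarith) (by positivity)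
      linarith
    have h10 : K * m * w ≤ G * w := by gcongr
    have h11 : 0 < K * m * w := by positivity
    linarith
  -- Near the antipode `s` may vanish, but there the density itself decreases at rate `G / 2`.
  · have hw1 : 1 ≤ w := by linarith
    have h1 : G * c * w ≤ -(G * w) / 2 := by
      have : G * w * c ≤ G * w * (-(1 / 2)) := mul_le_mul_of_nonneg_left hc2 (by positivity)
      linarith
    have h2 : 8 * (3 * M * |s| - G * s ^ 2) ≤ G / 4 := by
      have hMG : 576 * M ≤ G := hKm'.trans hG
      rw [← hss]
      nlinarith [mul_le_mul_of_nonneg_right hMG (abs_nonneg s),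
        mul_nonneg hG0.le (sq_nonneg (|s| - 1 / 8)), mul_nonneg hG0.le (sq_nonneg |s|)]
    have h3 : G * 1 ≤ G * w := by gcongr
    have h4 : K * m * w ≤ G * w := by gcongr
    linarith

namespace IsMeanField

variable {M K : ℝ} {F : ℝ × ℝ × ℝ → ℝ}

/-- Backward characteristics exist on every time interval. -/
theorem exists_characteristic (h : IsMeanField M K F) (hM : 0 ≤ M) (hK : 0 ≤ K) (θ : ℝ) {ω : ℝ}
    (hω : |ω| ≤ M) {t₀ t₁ : ℝ} (h0 : 0 ≤ t₀) (h01 : t₀ ≤ t₁) :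
    ∃ α : ℝ → ℝ, α t₁ = θ ∧ ContinuousOn α (Icc t₀ t₁) ∧
      ∀ t ∈ Ioo t₀ t₁, HasDerivAt α (speed M K F (α t, ω, t)) t := by
  have hv := h.continuous_speed
  have hPL : IsPicardLindelof (fun t x => speed M K F (x, ω, t))
      (⟨t₁, h01, le_rfl⟩ : Icc t₀ t₁) θ
      (((M + K) * (t₁ - t₀)).toNNReal) 0 (M + K).toNNReal K.toNNReal := by
    refine ⟨fun t ht => ?_, fun x _ => ?_, fun t ht x _ => ?_, ?_⟩
    · refine LipschitzWith.lipschitzOnWith (lipschitzWith_of_nnnorm_deriv_le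
        (fun x => (IsTransported.hasDerivAt_velocity K ω (orderCos M F t) (orderSin M F t)
          x).differentiableAt) fun x => ?_)
      change ‖deriv (fun ϑ => ω - K * (sin ϑ * orderCos M F t - cos ϑ * orderSin M F t)) x‖₊ ≤ _
      rw [(IsTransported.hasDerivAt_velocity K ω (orderCos M F t) (orderSin M F t) x).deriv]
      rw [← NNReal.coe_le_coe, coe_nnnorm, Real.coe_toNNReal _ hK, norm_eq_abs, abs_neg, abs_mul,
        abs_of_nonneg hK]
      exact mul_le_of_le_one_right hK ((abs_component_le M F x t).2.trans
        (h.orderNorm_le_one (h0.trans ht.1)))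
    · exact (by fun_prop : Continuous fun t => speed M K F (x, ω, t)).continuousOn
    · rw [Real.coe_toNNReal _ (by positivity), norm_eq_abs]
      exact h.abs_speed_le hK x hω (h0.trans ht.1)
    · have : 0 ≤ (M + K) * (t₁ - t₀) := mul_nonneg (by positivity) (by linarith)
      rw [Real.coe_toNNReal _ (by positivity), Real.coe_toNNReal _ this]
      simp [h01]
  obtain ⟨α, hα, hd⟩ := hPL.exists_eq_forall_mem_Icc_hasDerivWithinAt
    (x := θ) (by simp)
  exact ⟨α, hα, fun t ht => (hd t ht).continuousWithinAt, fun t ht =>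
    (hd t ⟨ht.1.le, ht.2.le⟩).hasDerivAt (Icc_mem_nhds ht.1 ht.2)⟩

/-- The weighted density decays exponentially, once the order parameter rotates slowly in the frame
of the mean natural frequency. -/
theorem mul_weight_le (h : IsMeanField M K F) {m φ₀ T L : ℝ} (hM : 0 < M) (hK : 0 < K)
    (hm : 0 < m) (hKm : 576 * M ≤ K * m ^ 2) (hT : 0 ≤ T)
    (hR : ∀ t, 0 ≤ t → m ≤ orderNorm M F t)
    (hpolar : ∀ t, 0 ≤ t → orderCos M F t = orderNorm M F t * cos (phase M K m φ₀ F t) ∧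
      orderSin M F t = orderNorm M F t * sin (phase M K m φ₀ F t))
    (hslow : ∀ t, T ≤ t → |phaseSpeed M K m F t - meanFreq M F| ≤ M)
    (hL : ∀ θ ω, |ω| ≤ M → F (θ, ω, T) ≤ L) (θ : ℝ) {ω t : ℝ} (hω : |ω| ≤ M) (ht : T ≤ t) :
    F (θ, ω, t) * weight (1 - M / K / 8) (θ - phase M K m φ₀ F t)
      ≤ L * 2 ^ 8 * exp (-(K * m / 4) * (t - T)) := by
  set φ := phase M K m φ₀ F with hφ
  set κ := 1 - M / K / 8 with hκ
  have hκ1 : κ ≤ 1 := by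
    have : 0 < M / K := by positivity
    linarith
  have hφc : Continuous φ := h.continuous_phase hm φ₀
  have hF := h.continuous
  have hWc : Continuous (weight κ) :=
    continuous_iff_continuousAt.2 fun x => (hasDerivAt_weight κ x).continuousAt
  obtain ⟨α, hα, hαc, hαd⟩ := h.exists_characteristic hM.le hK.le θ hω hT ht
  have hmono : -(F (α T, ω, T) * weight κ (α T - φ T) * exp (K * m / 4 * T))
      ≤ -(F (α t, ω, t) * weight κ (α t - φ t) * exp (K * m / 4 * t)) := by
    refine le_of_hasDerivAt_nonneg
      (X := fun τ => -(F (α τ, ω, τ) * weight κ (α τ - φ τ) * exp (K * m / 4 * τ))) ht ?_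
      fun τ hτ => ?_
    · have h1 : ContinuousOn (fun τ => F (α τ, ω, τ)) (Icc T t) :=
        hF.comp_continuousOn (hαc.prodMk (continuousOn_const.prodMk continuousOn_id))
      have h2 : ContinuousOn (fun τ => weight κ (α τ - φ τ)) (Icc T t) :=
        hWc.comp_continuousOn (hαc.sub hφc.continuousOn)
      exact ((h1.mul h2).mul (by fun_prop)).neg
    · have hτ0 : 0 < τ := hT.trans_lt hτ.1
      obtain ⟨hC, hS⟩ := hpolar τ hτ0.le
      have hd := hαd τ hτ
      have hFd : HasDerivAt (fun σ => F (α σ, ω, σ))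
          (K * orderNorm M F τ * cos (α τ - φ τ) * F (α τ, ω, τ)) τ := by
        have h1 := (h.hasFDerivAt (α τ) ω hτ0).comp_hasDerivAt τ
          (hd.prodMk ((hasDerivAt_const τ ω).prodMk (hasDerivAt_id τ)))
        refine h1.congr_deriv ?_
        have h2 : ((speed M K F (α τ, ω, τ), 0, 1) : ℝ × ℝ × ℝ)
            = speed M K F (α τ, ω, τ) • ((1, 0, 0) : ℝ × ℝ × ℝ) + (0, 0, 1) := by simp
        rw [h2, map_add, map_smul, h.fderiv_time_eq (α τ) ω hτ0, hC, hS, cos_sub, smul_eq_mul,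
          speed, hC, hS]
        ring
      have hWd : HasDerivAt (fun σ => weight κ (α σ - φ σ)) _ τ :=
        HasDerivAt.comp (h := fun σ => α σ - φ σ) (h₂ := weight κ) τ
          (hasDerivAt_weight κ (α τ - φ τ)) (hd.fun_sub (h.hasDerivAt_phase_time hm φ₀ τ))
      have hed : HasDerivAt (fun σ => exp (K * m / 4 * σ)) _ τ :=
        ((hasDerivAt_id τ).const_mul (K * m / 4)).exp
      refine ⟨_, ((hFd.fun_mul hWd).fun_mul hed).fun_neg, ?_⟩
      have hFn := h.nonneg (α τ, ω, τ)
      have hexp := exp_pos (K * m / 4 * τ)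
      set x := α τ - φ τ with hx
      set w := max (κ - cos x) 0 with hw
      have hwn : 0 ≤ w := le_max_right _ _
      have hrate : w ^ 7 * (8 * sin x * (speed M K F (α τ, ω, τ) - phaseSpeed M K m F τ)
          + K * orderNorm M F τ * cos x * w + K * m / 4 * w) ≤ 0 := by
        rcases le_or_gt (κ - cos x) 0 with hle | hgt
        · rw [hw, max_eq_right hle]
          norm_num
        · refine mul_nonpos_of_nonneg_of_nonpos (pow_nonneg hwn 7) ?_
          rw [hw, max_eq_left hgt.le]
          have hspeed : speed M K F (α τ, ω, τ) = ω - K * orderNorm M F τ * sin x := by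
            rw [speed, hx, sin_sub, hC, hS]
            ring
          have hβ : |ω - phaseSpeed M K m F τ| ≤ 3 * M := by
            have e1 := abs_sub (ω - meanFreq M F) (phaseSpeed M K m F τ - meanFreq M F)
            rw [sub_sub_sub_cancel_right] at e1
            linarith [h.abs_relFreq_le hω, hslow τ hτ.1.le]
          have e2 := rate_le (G := K * orderNorm M F τ) hM hK hm
            ((hR 0 le_rfl).trans (h.orderNorm_le_one le_rfl)) hKm
            (mul_le_mul_of_nonneg_left (hR τ hτ0.le) hK.le) hβ (sin_sq_add_cos_sq x)
            (by linarith : cos x < 1 - M / K / 8)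
          rw [← hκ] at e2
          rw [hspeed]
          linarith
      have hval : weight κ x = w ^ 7 * w := by
        rw [weight, ← hw]
        ring
      rw [hval]
      have := mul_nonpos_of_nonneg_of_nonpos (mul_nonneg hFn hexp.le) hrate
      simp only [mul_one, id]
      linarith
  rw [hα] at hmono
  have hT' : F (α T, ω, T) * weight κ (α T - φ T) ≤ L * 2 ^ 8 :=
    mul_le_mul (hL _ _ hω) (weight_le hκ1 _) (weight_nonneg _ _)
      ((h.nonneg _).trans (hL (α T) ω hω))
  have h2 := (neg_le_neg_iff.1 hmono).trans
    (mul_le_mul_of_nonneg_right hT' (exp_pos (K * m / 4 * T)).le)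
  rw [← le_div_iff₀ (exp_pos _), mul_div_assoc, ← exp_sub] at h2
  refine h2.trans (le_of_eq ?_)
  congr 2
  ring

/-- The density is bounded at each time, by compactness and periodicity. -/
theorem exists_bound (h : IsMeanField M K F) (t : ℝ) :
    ∃ L, ∀ θ ω, |ω| ≤ M → F (θ, ω, t) ≤ L := by
  have hF := h.continuous
  obtain ⟨L, hL⟩ := (isCompact_box (-M) M).exists_bound_of_continuousOn
    (f := fun p => F (p.1, p.2, t)) (by fun_prop)
  refine ⟨L, fun θ ω hω => ?_⟩
  obtain ⟨y, hy, hyθ⟩ := (h.periodic ω t).exists_mem_Ico₀ (by positivity) θ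
  rw [hyθ]
  exact (le_abs_self _).trans (hL (y, ω) ⟨⟨hy.1, hy.2.le⟩, abs_le.1 hω⟩)

end IsMeanField

/-! ### The limit amplitude and the limit width -/

theorem limitAmplitude_eq (M K : ℝ) :
    limitAmplitude M K = 1 + M / K - √((M / K) ^ 2 + 4 * (M / K)) := by
  rw [limitAmplitude, div_pow]

theorem limitAmplitude_bounds {M K : ℝ} (ha : 0 < M / K) (ha' : M / K ≤ 1 / 16) :
    0 < limitAmplitude M K ∧ limitAmplitude M K ≤ 1 - M / K ∧
      3 * (M / K) ≤ (1 - limitAmplitude M K) ^ 2 := by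
  rw [limitAmplitude_eq]
  set a := M / K
  have hr : √(a ^ 2 + 4 * a) ^ 2 = a ^ 2 + 4 * a := sq_sqrt (by positivity)
  set r := √(a ^ 2 + 4 * a) with hrdef
  have hr0 : 0 ≤ r := sqrt_nonneg _
  have h1 : 2 * a ≤ r := le_sqrt_of_sq_le (by nlinarith)
  have h2 : r ≤ (1 + 2 * a) / 2 := sqrt_le_iff.2 ⟨by linarith, by nlinarith⟩
  refine ⟨by linarith, by linarith, ?_⟩
  nlinarith

theorem cos_half_baseWidth_le {M K : ℝ} (ha : 0 < M / K) (ha' : M / K ≤ 1 / 16) :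
    cos (baseWidth M K / 2) ≤ 1 - 3 * (M / K) / 8 := by
  obtain ⟨h1, h2, h3⟩ := limitAmplitude_bounds ha ha'
  set R := limitAmplitude M K with hR
  set a := M / K with haR
  have hs : 1 - R ≤ a * ((1 + R) / R ^ 2) + (1 - R) / R := by
    have e1 : 1 - R ≤ (1 - R) / R := by
      rw [le_div_iff₀ h1]
      nlinarith
    have e2 : 0 ≤ a * ((1 + R) / R ^ 2) := by positivity
    linarith
  have hcos : cos (baseWidth M K) ≤ 1 - 3 * a / 2 := by
    rw [baseWidth, ← hR, ← haR]
    set s := a * ((1 + R) / R ^ 2) + (1 - R) / R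
    have hs2 : 3 * a ≤ s ^ 2 := h3.trans (pow_le_pow_left₀ (by linarith) hs 2)
    rw [cos_arccos (by linarith [sqrt_nonneg (1 - s ^ 2)])
      (sqrt_le_one.2 (by linarith [sq_nonneg s]))]
    exact sqrt_le_iff.2 ⟨by linarith, by nlinarith⟩
  have hsq := cos_sq (baseWidth M K / 2)
  rw [mul_div_cancel₀ _ two_ne_zero] at hsq
  exact le_of_sq_le_sq (by nlinarith) (by linarith)

theorem tendsto_limitAmplitude (M : ℝ) :
    Tendsto (fun K : ℝ => limitAmplitude M K) atTop (𝓝 1) := by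
  have ha : Tendsto (fun K : ℝ => M / K) atTop (𝓝 0) := tendsto_const_nhds.div_atTop tendsto_id
  have hc : Continuous fun a : ℝ => 1 + a - √(a ^ 2 + 4 * a) := by fun_prop
  have := (hc.tendsto 0).comp ha
  norm_num at this
  exact this.congr fun K => (limitAmplitude_eq M K).symm

theorem tendsto_baseWidth (M : ℝ) : Tendsto (fun K : ℝ => baseWidth M K) atTop (𝓝 0) := by
  have ha : Tendsto (fun K : ℝ => M / K) atTop (𝓝 0) := tendsto_const_nhds.div_atTop tendsto_id
  have hR := tendsto_limitAmplitude M
  have h1 := (ha.mul ((hR.const_add 1).div (hR.pow 2) (by norm_num))).add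
    ((hR.const_sub 1).div hR one_ne_zero)
  have hc : Continuous fun s : ℝ => arccos √(1 - s ^ 2) :=
    continuous_arccos.comp (by fun_prop)
  have := (hc.tendsto _).comp h1
  norm_num at this
  exact this

/-- Points outside an arc have small cosine relative to its centre. -/
theorem cos_le_of_notMem_arc {θ c w ε : ℝ} (hw : 0 ≤ w) (hε : 0 ≤ ε) (h : θ ∉ arc c (w + ε)) :
    cos (θ - c) ≤ cos (w / 2) := by
  set n := round ((θ - c) / (2 * π)) with hn
  have h1 : (w + ε) / 2 ≤ |θ - (c + 2 * π * n)| := by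
    by_contra! hlt
    exact h ⟨n, hlt⟩
  have h2 : |θ - (c + 2 * π * n)| ≤ π := by
    -- Subtracting the nearest multiple of `2π` leaves a representative in `[-π, π]`.
    have e1 := abs_sub_round ((θ - c) / (2 * π))
    have e2 : θ - (c + 2 * π * n) = 2 * π * ((θ - c) / (2 * π) - n) := by
      field_simp
      ring
    rw [e2, abs_mul, abs_of_pos two_pi_pos]
    calc 2 * π * |(θ - c) / (2 * π) - n| ≤ 2 * π * (1 / 2) := by gcongr
      _ = π := by ring
  have h3 : cos (θ - c) = cos |θ - (c + 2 * π * n)| := by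
    rw [cos_abs, ← cos_sub_int_mul_two_pi (θ - c) n]
    congr 1
    ring
  rw [h3]
  exact cos_le_cos_of_nonneg_of_le_pi (by positivity) h2 (by linarith)

/-! ### Asymptotic behaviour -/

namespace IsMeanField

variable {M K : ℝ} {F : ℝ × ℝ × ℝ → ℝ}

/-- The density decays uniformly in the region where the weight is bounded below, with `φ` the
argument of the order parameter. -/
theorem exists_decay (h : IsMeanField M K F) {m B : ℝ} {P q : ℝ → ℝ} (hP : IsSawtooth P q B)
    (hs : IsStrong M K m B) (hKm : 576 * M ≤ K * m ^ 2) (hR₀ : orderNorm M F 0 = 2 * m) :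
    ∃ (φ d : ℝ → ℝ) (T : ℝ), 0 ≤ T ∧ Tendsto d atTop (𝓝 0) ∧
      (∀ t, 0 ≤ t → orderCos M F t = orderNorm M F t * cos (φ t) ∧
        orderSin M F t = orderNorm M F t * sin (φ t)) ∧
      ∀ θ ω t, |ω| ≤ M → T ≤ t → cos (θ - φ t) ≤ 1 - M / K / 4 → F (θ, ω, t) ≤ d t := by
  have hm := hs.bound_pos
  have hK := hs.coupling_pos
  have hM := hs.freq_pos
  have hR : ∀ t, 0 ≤ t → m ≤ orderNorm M F t := fun t ht => h.le_orderNorm hP hs hR₀ ht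
  obtain ⟨φ₀, hC₀, hS₀⟩ := exists_phase M F 0
  have hpolar : ∀ t, 0 ≤ t → orderCos M F t = orderNorm M F t * cos (phase M K m φ₀ F t) ∧
      orderSin M F t = orderNorm M F t * sin (phase M K m φ₀ F t) := fun t ht =>
    h.orderCos_orderSin_eq hm ht (fun τ hτ => hR τ hτ.1) hC₀ hS₀
  have hD := h.tendsto_dissipation hP hs hR hpolar
  obtain ⟨T₀, hT₀⟩ := eventually_atTop.1 (hD.eventually_lt_const (by positivity : 0 < (m * M) ^ 2))
  set T := max T₀ 0 with hT
  have hslow : ∀ t, T ≤ t → |phaseSpeed M K m F t - meanFreq M F| ≤ M := by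
    intro t ht
    have ht0 : 0 ≤ t := (le_max_right _ _).trans ht
    have h1 := (h.sq_phaseSpeed_sub_le hm ht0 (hR t ht0)).trans
      (hT₀ t ((le_max_left _ _).trans ht)).le
    rw [mul_pow] at h1
    exact abs_le_of_sq_le_sq (le_of_mul_le_mul_left h1 (by positivity)) hM.le
  obtain ⟨L, hL⟩ := h.exists_bound T
  have ha : 0 < M / K := by positivity
  refine ⟨phase M K m φ₀ F,
    fun t => L * 2 ^ 8 * exp (-(K * m / 4) * (t - T)) / (M / K / 8) ^ 8, T, le_max_right _ _, ?_,
    hpolar, fun θ ω t hω ht hcos => ?_⟩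
  · have h1 : Tendsto (fun t : ℝ => -(K * m / 4) * (t - T)) atTop atBot :=
      (tendsto_atTop_add_const_right atTop (-T) tendsto_id).const_mul_atTop_of_neg
        (by simp only [neg_lt_zero]; positivity)
    simpa using ((tendsto_exp_atBot.comp h1).const_mul (L * 2 ^ 8)).div_const ((M / K / 8) ^ 8)
  · rw [le_div_iff₀ (by positivity)]
    refine le_trans (mul_le_mul_of_nonneg_left ?_ (h.nonneg _))
      (h.mul_weight_le hM hK hm hKm (le_max_right _ _) hR hpolar hslow hL θ hω ht)
    refine pow_le_pow_left₀ (by positivity) (le_max_of_le_left ?_) 8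
    linarith

/-- The order parameter is close to one when the density is small away from the average phase. -/
theorem one_sub_orderNorm_le (h : IsMeanField M K F) {φ a d t : ℝ} (ht : 0 ≤ t) (hd : 0 ≤ d)
    (ha : 0 ≤ a)
    (hC : orderCos M F t = orderNorm M F t * cos φ)
    (hS : orderSin M F t = orderNorm M F t * sin φ)
    (hdecay : ∀ θ ω, |ω| ≤ M → cos (θ - φ) ≤ 1 - a → F (θ, ω, t) ≤ d) :
    1 - orderNorm M F t ≤ a + 2 * d * volume.real (box (-M) M) := by
  have hF := h.continuous
  have h1 : orderNorm M F t = ∫ p in box (-M) M, cos (p.1 - φ) * F (p.1, p.2, t) := by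
    have h2 := h.average_linear (sin φ) (-cos φ) t
    have h3 : ∀ p : ℝ × ℝ, cos (p.1 - φ) = sin p.1 * sin φ - cos p.1 * -cos φ := fun p => by
      rw [cos_sub]
      ring
    simp only [h3]
    rw [h2, hC, hS]
    linear_combination -(orderNorm M F t) * sin_sq_add_cos_sq φ
  rw [h1]
  nth_rewrite 1 [← h.mass t ht]
  rw [← integral_sub (integrableOn_box (by fun_prop) _ _) (integrableOn_box (by fun_prop) _ _)]
  have h4 : a + 2 * d * volume.real (box (-M) M)
      = ∫ p in box (-M) M, (a * F (p.1, p.2, t) + 2 * d) := by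
    rw [integral_add (integrableOn_box (by fun_prop) _ _) (integrableOn_box (by fun_prop) _ _),
      h.average_const a ht, setIntegral_const, smul_eq_mul, mul_comm (2 * d)]
  rw [h4]
  refine setIntegral_mono_on (integrableOn_box (by fun_prop) _ _)
    (integrableOn_box (by fun_prop) _ _) (measurableSet_box _ _) fun p hp => ?_
  have hn := h.nonneg (p.1, p.2, t)
  rcases le_total (cos (p.1 - φ)) (1 - a) with hcos | hcos
  · have e1 := hdecay p.1 p.2 (abs_le.2 hp.2) hcos
    have e2 := neg_one_le_cos (p.1 - φ)
    nlinarith [mul_nonneg ha hn]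
  · nlinarith

end IsMeanField

theorem IsClassicalSolution.amplitude_eq {K : ℝ} {f : ℝ → ℝ → ℝ → ℝ}
    (hf : IsClassicalSolution K f) {M : ℝ} (hs : tsupport (frequencyDensity f) ⊆ Icc (-M) M)
    {t : ℝ} (ht : 0 ≤ t) : amplitude f t = orderNorm M (extend f) t := by
  rw [amplitude, hf.complexOrder_eq hs ht, Complex.norm_add_mul_I, orderNorm]

/-- The cosine relative to an average phase does not depend on the choice of the phase. -/
theorem IsAveragePhase.cos_sub_eq {K : ℝ} {f : ℝ → ℝ → ℝ → ℝ} {φ : ℝ → ℝ}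
    (hφ : IsAveragePhase f φ) (hf : IsClassicalSolution K f) {M : ℝ}
    (hs : tsupport (frequencyDensity f) ⊆ Icc (-M) M) {t ψ : ℝ} (ht : 0 ≤ t)
    (hpos : 0 < orderNorm M (extend f) t)
    (hC : orderCos M (extend f) t = orderNorm M (extend f) t * cos ψ)
    (hS : orderSin M (extend f) t = orderNorm M (extend f) t * sin ψ) (θ : ℝ) :
    cos (θ - φ t) = cos (θ - ψ) := by
  have h1 := hφ t ht
  rw [hf.complexOrder_eq hs ht, hf.amplitude_eq hs ht, Complex.exp_mul_I] at h1
  have hre := congrArg Complex.re h1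
  have him := congrArg Complex.im h1
  simp only [Complex.mul_re, Complex.mul_im, Complex.add_re, Complex.add_im, Complex.ofReal_re,
    Complex.ofReal_im, Complex.I_re, Complex.I_im, Complex.cos_ofReal_re, Complex.cos_ofReal_im,
    Complex.sin_ofReal_re, Complex.sin_ofReal_im, mul_zero, zero_mul, mul_one, sub_zero, add_zero,
    zero_add] at hre him
  rw [hC] at hre
  rw [hS] at him
  rw [cos_sub, cos_sub, mul_left_cancel₀ hpos.ne' hre, mul_left_cancel₀ hpos.ne' him]

end KuramotoSakaguchi

end

open KuramotoSakaguchi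

theorem theorem3p3 (M : ℝ) (hM : 0 < M) :
    (∀ R₀ : ℝ, 0 < R₀ → ∃ K₀ : ℝ, 0 < K₀ ∧ ∀ K : ℝ, K₀ < K →
      ∀ f : ℝ → ℝ → ℝ → ℝ, KuramotoSakaguchi.IsClassicalSolution K f →
        tsupport (KuramotoSakaguchi.frequencyDensity f) ⊆ Icc (-M) M →
        KuramotoSakaguchi.amplitude f 0 = R₀ →
        KuramotoSakaguchi.limitAmplitude M K
            ≤ liminf (fun t : ℝ => KuramotoSakaguchi.amplitude f t) atTop ∧
        ∀ ε : ℝ, 0 < ε → ε < 1 →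
          ∀ φ : ℝ → ℝ, KuramotoSakaguchi.IsAveragePhase f φ →
            Tendsto (fun t : ℝ => KuramotoSakaguchi.supNormOutside f t
                (KuramotoSakaguchi.arc (φ t) (KuramotoSakaguchi.baseWidth M K + ε)))
              atTop (𝓝 0)) ∧
    Tendsto (fun K : ℝ => KuramotoSakaguchi.limitAmplitude M K) atTop (𝓝 1) ∧
    Tendsto (fun K : ℝ => KuramotoSakaguchi.baseWidth M K) atTop (𝓝 0) := by
  refine ⟨fun R₀ hR₀ => ?_, tendsto_limitAmplitude M, tendsto_baseWidth M⟩
  obtain ⟨P, q, B, hP⟩ := exists_isSawtooth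
  have hB := hP.pos
  obtain ⟨m, rfl⟩ : ∃ m, R₀ = 2 * m := ⟨R₀ / 2, by ring⟩
  have hm : 0 < m := by linarith
  -- One summand for each largeness condition on `K`; `16 * M` makes `M / K ≤ 1 / 16`.
  refine ⟨16 * M + 8 * M / m + 16 * M * B * (1 + 8 / m ^ 2) / m + 4 * M * B / m ^ 2
    + 576 * M / m ^ 2, by positivity, fun K hK f hf hsupp hamp => ?_⟩
  have e1 : 0 < 8 * M / m := by positivity
  have e2 : 0 < 16 * M * B * (1 + 8 / m ^ 2) / m := by positivity
  have e3 : 0 < 4 * M * B / m ^ 2 := by positivity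
  have e4 : 0 < 576 * M / m ^ 2 := by positivity
  have hK0 : 0 < K := by linarith
  have hs : IsStrong M K m B :=
    { freq_pos := hM
      coupling_pos := hK0
      bound_pos := hm
      two_freq_le := by linarith
      freq_le := (div_le_iff₀ hm).1 (by linarith)
      absorb := (div_le_iff₀ hm).1 (by linarith)
      gap := (div_lt_iff₀ (by positivity)).1 (by linarith) }
  have hKm : 576 * M ≤ K * m ^ 2 := (div_le_iff₀ (by positivity)).1 (by linarith)
  have ha : 0 < M / K := by positivity
  have ha' : M / K ≤ 1 / 16 := by
    rw [div_le_iff₀ hK0]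
    linarith
  have h := hf.isMeanField hsupp
  rw [hf.amplitude_eq hsupp le_rfl] at hamp
  have hpos : ∀ t, 0 ≤ t → 0 < orderNorm M (extend f) t := fun t ht =>
    hm.trans_le (h.le_orderNorm hP hs hamp ht)
  obtain ⟨ψ, d, T, hT, hd, hpolar, hdecay⟩ := h.exists_decay hP hs hKm hamp
  constructor
  · refine le_liminf_of_le ?_ ?_
    · refine IsBoundedUnder.isCoboundedUnder_ge ⟨1, ?_⟩
      rw [eventually_map]
      filter_upwards [eventually_ge_atTop 0] with t ht
      rw [hf.amplitude_eq hsupp ht]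
      exact h.orderNorm_le_one ht
    · have hlim : Tendsto (fun t => M / K / 4 + 2 * |d t| * volume.real (box (-M) M)) atTop
          (𝓝 (M / K / 4)) := by
        simpa using ((hd.abs.const_mul 2).mul_const (volume.real (box (-M) M))).const_add
          (M / K / 4)
      filter_upwards [hlim.eventually_lt_const (by linarith : M / K / 4 < M / K),
        eventually_ge_atTop T] with t ht htT
      have ht0 := hT.trans htT
      rw [hf.amplitude_eq hsupp ht0]
      have h1 := h.one_sub_orderNorm_le (a := M / K / 4) (d := |d t|) ht0 (abs_nonneg _)
        (by positivity) (hpolar t ht0).1 (hpolar t ht0).2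
        fun θ ω hω hcos => (hdecay θ ω t hω htT hcos).trans (le_abs_self _)
      linarith [(limitAmplitude_bounds ha ha').2.1]
  · intro ε hε _ φ hφ
    have hlim : Tendsto (fun t => ENNReal.ofReal |d t|) atTop (𝓝 0) := by
      simpa using ENNReal.tendsto_ofReal hd.abs
    refine tendsto_of_tendsto_of_tendsto_of_le_of_le' tendsto_const_nhds hlim
      (Eventually.of_forall fun _ => zero_le) ?_
    filter_upwards [eventually_ge_atTop T] with t ht
    have ht0 := hT.trans ht
    rw [supNormOutside, eLpNorm_exponent_top]
    refine eLpNormEssSup_le_of_ae_bound (Eventually.of_forall fun p => ?_)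
    by_cases hp : p.1 ∈ arc (φ t) (baseWidth M K + ε)
    · rw [indicator_of_notMem (by simpa using hp), norm_zero]
      exact abs_nonneg _
    rw [indicator_of_mem (by simpa using hp), norm_of_nonneg (hf.nonneg _ _ _ ht0),
      ← extend_apply f p.1 p.2 ht0]
    by_cases hω : |p.2| ≤ M
    · refine (hdecay p.1 p.2 t hω ht ?_).trans (le_abs_self _)
      rw [← hφ.cos_sub_eq hf hsupp ht0 (hpos t ht0) (hpolar t ht0).1 (hpolar t ht0).2]
      have h1 := cos_le_of_notMem_arc (arccos_nonneg _) hε.le hp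
      have h2 := cos_half_baseWidth_le ha ha'
      exact h1.trans (h2.trans (by linarith))
    · rw [h.eq_zero p.1 p.2 t ht0 (not_le.1 hω)]
      exact abs_nonneg _
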